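/- **Setting.** Let $y_i=x_i^T\beta^*+\epsilon_i$, $i=1,\dots,n$, where the pairs $(x_i,\epsilon_i)\in\mathbb R^p\times\mathbb R$ are i.i.d. and $x_i$ is independent of $\epsilon_i$, with $E\epsilon_i=0$ and $Ex_i=0$. The $p$ coefficients are partitioned into $J$ nonempty groups $I_1,\dots,I_J$ of sizes $d_j=|I_j|$; $\beta_j$ denotes the subvector of $\beta$ on $I_j$. Put $d_a=\max_j d_j$, $d_b=\min_j d_j$, $d=\sqrt{d_a/d_b}$. Let $S\subseteq\{1,\dots,J\}$ be nonempty with $\beta^*_j=0$ for $j\notin S$, and put $s=|S|$, $I_S=\bigcup_{j\in S}I_j$, $k=|I_S|$, $I_0=\{m:\beta^*_m\ne0\}$, $\beta^{*G}_{\min}=\min_{j\in S}\|\beta^*_j\|_2$, $\beta^{*I}_{\min}=\min_{m\in I_0}|\beta^*_m|$. Let $$\mathcal L_n(\beta)=\frac1n\sum_{i=1}^n\frac{w(x_i)}{v(x_i)}\,l\big((y_i-x_i^T\beta)v(x_i)\big)$$ with measurable weight functions $w,v>0$. *Loss.* $l$ is differentiable, $l''$ exists almost everywhere, $|l'|\le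 k_1$, and $|l'(a)-l'(b)|\le k_2|a-b|$ for all $a,b$ ($0<k_1,k_2<\infty$). *Covariates and errors.* ($Z$ is sub-Gaussian with parameter $\sigma^2$ if $Ee^{t(Z-EZ)}\le e^{\sigma^2t^2/2}$ for all $t\in\mathbb R$.) For every $\nu\in\mathbb R^p$, $w(x_i)x_i^T\nu$ is sub-Gaussian with parameter at most $k_0^2\|\nu\|_2^2$; each $v(x_i)x_{im}$ is sub-Gaussian with parameter at most $k_3^2$; the means of $w(x_i)x_{im}$ and $v(x_i)x_{im}$ are at most $\kappa$ in absolute value; and either (a) $v(x_i)=1$ a.s. and $E[w(x_i)x_i]=0$, or (b) $E[l'(v(x_i)\epsilon_i)\mid x_i]=0$. *Penalty.* $\rho:\mathbb R\times\mathbb R\to\mathbb R$ is $(\mu,\delta)$-amenable with $\mu,\delta>0$: for each $t>0$, $\rho(t,\cdot)$ is non-decreasing on $(0,\infty)$; there is $g:(0,\infty)\to(0,\infty)$ with $\rho(t,c\lambda)/\rho(t,\lambda)\le g(c)$ for all $c\ge1$ and $t,\lambda>0$; and for every $\lambda>0$: $\rho(\cdot,\lambda)$ is even with $\rho(0,\lambda)=0$,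 is non-decreasing on $(0,\infty)$ and differentiable off $0$, $\rho(t,\lambda)/t$ is non-increasing in $t>0$, $\lim_{t\to0^+}\partial_t\rho(t,\lambda)=\lambda$, $\rho(t,\lambda)+\frac\mu2t^2$ is convex in $t$, and $\partial_t\rho(t,\lambda)=0$ for $t\ge\delta\lambda$. *Restricted strong convexity (RSC)* with $\gamma,\tau,r>0$: for all $\beta_1,\beta_2$ with $\|\beta_i-\beta^*\|_2\le r$, $$\langle\nabla\mathcal L_n(\beta_1)-\nabla\mathcal L_n(\beta_2),\beta_1-\beta_2\rangle\ge\gamma\|\beta_1-\beta_2\|_2^2-\tau\frac{\log p}n\|\beta_1-\beta_2\|_1^2.$$ *Estimators.* A stationary point $\hat\beta$ of the group-penalized program $$\min_{\|\beta\|_1\le R}\Big\{\mathcal L_n(\beta)+\rho_\lambda(\beta)\Big\},\qquad \rho_\lambda(\beta)=\sum_{j=1}^J\rho(\|\beta_j\|_2,\sqrt{d_j}\lambda),$$ is a feasible point such that $\langle\nabla\mathcal L_n(\hat\beta)+u,\beta-\hat\beta\rangle\ge0$ for all feasible $\beta$ near $\hat\beta$, for some generalized gradient $u$ of $\rho_\lambda$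 at $\hat\beta$ (on a group with $\hat\beta_j\neq0$, $u_j$ is the ordinary gradient of $\rho(\|\beta_j\|_2,\sqrt{d_j}\lambda)$; on a group with $\hat\beta_j=0$, $\|u_j\|_2\le\sqrt{d_j}\lambda$). It lies in the RSC region if $\|\hat\beta-\beta^*\|_2\le r$. The oracle estimator $\hat\beta^{\mathcal O}$ is the minimizer of $\mathcal L_n$ over $\{\beta:\operatorname{supp}\beta\subseteq I_S,\ \|\beta-\beta^*\|_2\le r\}$. The hard-thresholded estimator is $\hat\beta^h(\theta)_m=\hat\beta_m\mathbf 1(|\hat\beta_m|\ge\theta)$. **Theorem.** Suppose $\frac34\mu<\gamma$. There are positive constants $C_4,C_5,C_7,C_6'$ depending only on $k_0,k_1,k_2,k_3,\kappa,K,\gamma,\tau,\mu,\delta$, for every $C_6>C_6'$ positive constants $C,C_8$ depending in addition only on $C_6$, and for every $r>0$ a positive constant $C_0$ depending in addition only on $r$, such that the following holds in the setting above. Suppose - $\lambda=C_6\sqrt{\log p/n}$, $\lambda\ge8\tau R\frac{\log p}n$, $R>\frac{12(1+3g(d))d_a\lambda s}{4\gamma-3\mu}$, $\|\beta^*\|_1\le\frac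 R2$; - $n\ge Cr^{-2}d_as\log p$, $n\ge C_0k\log p$, $k^2\log k\le K\log p$; - $\beta^{*G}_{\min}\ge C_8\sqrt{d_a\log p/n}$, $\ \beta^{*I}_{\min}\ge C_5\sqrt{\frac{\log p}{kn}}+\theta$, $\ \theta>C_5\sqrt{\frac{\log p}{kn}}$. Then there is an event of probability at least $1-C_7\exp(-C_4\log p/k^2)$ on which, whenever $\mathcal L_n$ satisfies RSC with $\gamma,\tau,r$, the program has a stationary point in the RSC region, the oracle estimator $\hat\beta^{\mathcal O}$ exists and is unique, and every stationary point $\hat\beta$ in the RSC region satisfies $$\hat\beta^h(\theta)=(\hat\beta^{\mathcal O}_{I_0},0_{I_0^c}),\qquad \|\hat\beta^h(\theta)-\beta^*\|_2\le C_5\sqrt{\frac{\log p}{kn}},$$ and the set of nonzero coefficients of $\hat\beta^h(\theta)$ is exactly $I_0$ (bi-level selection consistency). -/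

import Mathlib

open MeasureTheory ProbabilityTheory Filter Topology
open scoped NNReal

noncomputable section

namespace BiLevel

/-- The coefficient space, with the Euclidean norm. -/
abbrev Vec (p : ℕ) := EuclideanSpace ℝ (Fin p)

/-- The `ℓ₁` norm of a coefficient vector. -/
def l1norm {p : ℕ} (β : Vec p) : ℝ := ∑ m, |β m|

/-! ### Groups of coefficients

The groups are given by a map `grp` sending each of the `p` coefficients to its group. -/

/-- The size `d_j` of group `j`. -/
def groupSize {p J : ℕ} (grp : Fin p → Fin J) (j : Fin J) : ℕ :=
  (Finset.univ.filter fun m => grp m = j).card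

/-- The largest group size `d_a`. -/
def maxSize {p J : ℕ} (grp : Fin p → Fin J) : ℕ := ⨆ j, groupSize grp j

/-- The smallest group size `d_b`. -/
def minSize {p J : ℕ} (grp : Fin p → Fin J) : ℕ := ⨅ j, groupSize grp j

/-- The ratio `d = √(d_a / d_b)`. -/
def sizeRatio {p J : ℕ} (grp : Fin p → Fin J) : ℝ :=
  Real.sqrt ((maxSize grp : ℝ) / (minSize grp : ℝ))

/-- `‖β_j‖₂`, the Euclidean norm of the subvector of `β` in group `j`. -/
def groupNorm {p J : ℕ} (grp : Fin p → Fin J) (β : Vec p) (j : Fin J) : ℝ :=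
  Real.sqrt (∑ m ∈ Finset.univ.filter (fun m => grp m = j), β m ^ 2)

/-- `I_S`, the coefficients that belong to the groups in `S`. -/
def groupIndices {p J : ℕ} (grp : Fin p → Fin J) (S : Finset (Fin J)) : Finset (Fin p) :=
  Finset.univ.filter fun m => grp m ∈ S

/-! ### Penalty -/

/-- `μ`-amenable penalties `ρ(t, lam)`, with the function `g` that controls the
dependence on the second argument. -/
structure IsAmenable (ρ : ℝ → ℝ → ℝ) (g : ℝ → ℝ) (μ : ℝ) : Prop where
  mono_right : ∀ t, 0 < t → MonotoneOn (fun lam => ρ t lam) (Set.Ioi 0)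
  g_pos : ∀ c, 0 < c → 0 < g c
  ratio_le : ∀ c, 1 ≤ c → ∀ t, 0 < t → ∀ lam, 0 < lam → ρ t (c * lam) / ρ t lam ≤ g c
  symm : ∀ lam, 0 < lam → ∀ t, ρ (-t) lam = ρ t lam
  zero : ∀ lam, 0 < lam → ρ 0 lam = 0
  mono_left : ∀ lam, 0 < lam → MonotoneOn (fun t => ρ t lam) (Set.Ioi 0)
  div_anti : ∀ lam, 0 < lam → AntitoneOn (fun t => ρ t lam / t) (Set.Ioi 0)
  diff : ∀ lam, 0 < lam → ∀ t, t ≠ 0 → DifferentiableAt ℝ (fun t => ρ t lam) t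
  deriv_zero : ∀ lam, 0 < lam →
    Tendsto (deriv fun t => ρ t lam) (𝓝[>] 0) (𝓝 lam)
  weak_convex : ∀ lam, 0 < lam →
    ConvexOn ℝ Set.univ (fun t => ρ t lam + μ / 2 * t ^ 2)

/-- `(μ, δ)`-amenable penalties. -/
structure IsFlatAmenable (ρ : ℝ → ℝ → ℝ) (g : ℝ → ℝ) (μ δ : ℝ) : Prop
    extends IsAmenable ρ g μ where
  flat : ∀ lam, 0 < lam → ∀ t, δ * lam ≤ t → deriv (fun t => ρ t lam) t = 0

/-- `u` is a (generalized) gradient at `β` of the group penalty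
`ρ_lam(β) = ∑ j, ρ(‖β_j‖₂, √d_j lam)`. On a group with `β_j ≠ 0` it is the ordinary gradient;
on a group with `β_j = 0` it is `√d_j lam z` for a subgradient `z` (`‖z‖₂ ≤ 1`) of the Euclidean
norm at `0`. -/
def IsPenaltyGradient {p J : ℕ} (grp : Fin p → Fin J) (ρ : ℝ → ℝ → ℝ) (lam : ℝ)
    (β u : Vec p) : Prop :=
  ∀ j : Fin J,
    (groupNorm grp β j ≠ 0 → ∀ m, grp m = j →
      u m = deriv (fun t => ρ t (Real.sqrt (groupSize grp j) * lam)) (groupNorm grp β j)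
        * (β m / groupNorm grp β j)) ∧
    (groupNorm grp β j = 0 → groupNorm grp u j ≤ Real.sqrt (groupSize grp j) * lam)

/-! ### Loss -/

/-- Assumptions on the residual function `l`: bounded (by `k₁`) and `k₂`-Lipschitz derivative. -/
structure IsRobustLoss (l : ℝ → ℝ) (k₁ k₂ : ℝ) : Prop where
  diff : Differentiable ℝ l
  diff_two : ∀ᵐ u, DifferentiableAt ℝ (deriv l) u
  bounded : ∀ u, |deriv l u| ≤ k₁
  lipschitz : ∀ a b, |deriv l a - deriv l b| ≤ k₂ * |a - b|

/-- The empirical loss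
`L_n(β) = (1/n) ∑ i, w(x_i) / v(x_i) * l((y_i - x_iᵀ β) v(x_i))`. -/
def empLoss {n p : ℕ} (l : ℝ → ℝ) (w v : Vec p → ℝ) (x : Fin n → Vec p) (y : Fin n → ℝ)
    (β : Vec p) : ℝ :=
  (1 / (n : ℝ)) * ∑ i, w (x i) / v (x i) * l ((y i - inner ℝ (x i) β) * v (x i))

/-- Restricted strong convexity of a loss `L`, in the ball of radius `r` around `βs`. -/
def RSC {p : ℕ} (n : ℕ) (L : Vec p → ℝ) (βs : Vec p) (γ τ r : ℝ) : Prop :=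
  ∀ β₁ β₂ : Vec p, ‖β₁ - βs‖ ≤ r → ‖β₂ - βs‖ ≤ r →
    γ * ‖β₁ - β₂‖ ^ 2 - τ * (Real.log p / n) * l1norm (β₁ - β₂) ^ 2
      ≤ inner ℝ (gradient L β₁ - gradient L β₂) (β₁ - β₂)

/-! ### Sample -/

/-- The linear model `y_i = x_iᵀ βs + ε_i`: the pairs `(x_i, ε_i)` are i.i.d., with
independent `x_i` and `ε_i`. -/
structure IsLinearModel {Ω : Type*} [MeasurableSpace Ω] (P : Measure Ω) {n p : ℕ}
    (βs : Vec p) (X : Fin n → Ω → Vec p) (ε Y : Fin n → Ω → ℝ) : Prop where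
  meas_X : ∀ i, Measurable (X i)
  meas_ε : ∀ i, Measurable (ε i)
  indep : iIndepFun (fun i ω => (X i ω, ε i ω)) P
  ident : ∀ i i', IdentDistrib (fun ω => (X i ω, ε i ω)) (fun ω => (X i' ω, ε i' ω)) P P
  indep_X_ε : ∀ i, IndepFun (X i) (ε i) P
  model : ∀ i ω, Y i ω = inner ℝ (X i ω) βs + ε i ω

/-- `Z` is sub-Gaussian with parameter (at most) `c`:
`E exp(t (Z - E Z)) ≤ exp(c t² / 2)` for all real `t`. -/
def IsSubGaussian {Ω : Type*} [MeasurableSpace Ω] (P : Measure Ω) (Z : Ω → ℝ) (c : ℝ≥0) : Prop :=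
  HasSubgaussianMGF (fun ω => Z ω - ∫ ω', Z ω' ∂P) c P

/-- Assumptions on one error `e` and covariate vector `x`, with weights `w` and `v`. -/
structure IsErrorCovariate {Ω : Type*} [MeasurableSpace Ω] (P : Measure Ω) {p : ℕ}
    (l : ℝ → ℝ) (w v : Vec p → ℝ) (k₀ : ℝ≥0) (x : Ω → Vec p) (e : Ω → ℝ) : Prop where
  int_e : Integrable e P
  mean_e : ∫ ω, e ω ∂P = 0
  int_x : ∀ m, Integrable (fun ω => x ω m) P
  mean_x : ∀ m, ∫ ω, x ω m ∂P = 0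
  subgauss : ∀ ν : Vec p,
    IsSubGaussian P (fun ω => w (x ω) * inner ℝ (x ω) ν) (k₀ ^ 2 * ‖ν‖₊ ^ 2)
  centered :
    ((∀ᵐ ω ∂P, v (x ω) = 1) ∧ ∀ m, ∫ ω, w (x ω) * x ω m ∂P = 0) ∨
    P[fun ω => deriv l (v (x ω) * e ω) | MeasurableSpace.comap x inferInstance] =ᵐ[P] 0

/-! ### Estimators -/

/-- `β` is a stationary point of the program of minimizing `L(β) + ρ_lam(β)` over
`‖β‖₁ ≤ R`. -/
def IsStationary {p J : ℕ} (L : Vec p → ℝ) (grp : Fin p → Fin J) (ρ : ℝ → ℝ → ℝ)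
    (lam R : ℝ) (β : Vec p) : Prop :=
  l1norm β ≤ R ∧ ∃ u : Vec p, IsPenaltyGradient grp ρ lam β u ∧
    ∀ᶠ β' in 𝓝 β, l1norm β' ≤ R → 0 ≤ inner ℝ (gradient L β + u) (β' - β)

/-- `β` is the zero-padded group-level oracle estimator: it minimizes `L` among the vectors
supported on `I` in the closed ball of radius `r` around `βs`. -/
def IsOracle {p : ℕ} (L : Vec p → ℝ) (I : Finset (Fin p)) (βs : Vec p) (r : ℝ)
    (β : Vec p) : Prop :=
  ((∀ m, m ∉ I → β m = 0) ∧ ‖β - βs‖ ≤ r) ∧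
    ∀ β' : Vec p, (∀ m, m ∉ I → β' m = 0) → ‖β' - βs‖ ≤ r → L β ≤ L β'

/-- The hard-thresholded vector `β · 1(|β| ≥ θ)`. -/
def hardThreshold {p : ℕ} (θ : ℝ) (β : Vec p) : Vec p :=
  WithLp.toLp 2 fun m => if θ ≤ |β m| then β m else 0

/-- The vector `(β_{I₀}, 0)`, where `I₀` is the set of nonzero coefficients of `βs`. -/
def restrictSupport {p : ℕ} (βs β : Vec p) : Vec p :=
  WithLp.toLp 2 fun m => if βs m ≠ 0 then β m else 0

end BiLevel

end

/-!
The argument compares every stationary point directly with the oracle; no a priori error bound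
for stationary points is needed. Write `q = √(log p / n)`.

*Probability.* At the true vector the gradient of the loss is an average of the scores
`w(x_i) x_{im} l'(v(x_i) ε_i)`. They are centered under either alternative of the assumptions
(`integral_score`), and have exponential moments of their square, because the weighted covariates
are sub-Gaussian and `l'` is bounded (`hasExpSq_of_subgaussian`, `HasExpSq.score`). Chernoff's
bound and the union bound give an event (`exists_regular_event`) on which the gradient is `O(q)` in
all `p` coefficients and `O(q / k)` in the `k` coefficients of `I_S`, and the empirical second
moments of the weighted covariates are bounded. The bound `O(q / k)` is what limits the probability
to `1 - O(exp (-log p / k²))`; the union over `k` coefficients is paid by `k² log k ≤ K log p`.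

*The oracle.* On vectors supported in `I_S`, restricted strong convexity is strong convexity, so the
oracle is unique and its `ℓ₂` error is `O(q / √k)` (`IsOracle.norm_sub_le`). It is interior, hence a
critical point in the coefficients of `I_S`. Its `ℓ₁` error is `O(q)`, and the gradient is Lipschitz
from `ℓ₁` to `ℓ_∞` (`abs_lossGrad_sub_le`), so its gradient is at most `lam / 4` everywhere. Its
groups in `S` lie in the flat part of the penalty, so it is stationary
(`isStationary_of_critical`).

*Uniqueness.* For a stationary point `β` with difference `h` from the oracle, the variational
inequality and restricted strong convexity bound `γ ‖h‖²` by the contributions of the penalty and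
of the gradient at the oracle (`IsStationary.eq_of_critical`). A group in `S` contributes only if
`β` is far from the oracle there, hence at most a small multiple of `‖h_j‖²`
(`IsPenaltyGradient.neg_groupInner_le`). A group outside `S` contributes
`-(lam / 2) ‖β_j‖₁ + (μ / 2) ‖β_j‖²` (`IsPenaltyGradient.le_groupInner_self`): since the penalty is
monotone, only half of its weak convexity has to be paid, which leaves room for `3 μ / 4 < γ`, and
the `ℓ₁` term absorbs the gradient at the oracle and the `ℓ₁` term of restricted strong convexity.
Hence `h = 0`, and hard thresholding the oracle gives the claim (`hardThreshold_eq`).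
-/

namespace BiLevel

/-! ### Derivatives of amenable penalties -/

namespace IsAmenable

variable {ρ : ℝ → ℝ → ℝ} {g : ℝ → ℝ} {μ lam : ℝ}

lemma deriv_nonneg (hρ : IsAmenable ρ g μ) (hlam : 0 < lam) {t : ℝ} (ht : 0 < t) :
    0 ≤ deriv (fun t => ρ t lam) t := by
  have h := (hρ.mono_left lam hlam).derivWithin_nonneg (x := t)
  rwa [derivWithin_of_isOpen isOpen_Ioi ht] at h

lemma deriv_add_mono (hρ : IsAmenable ρ g μ) (hlam : 0 < lam) {s t : ℝ} (hs : 0 < s)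
    (hst : s ≤ t) :
    deriv (fun t => ρ t lam) s + μ * s ≤ deriv (fun t => ρ t lam) t + μ * t := by
  have key : ∀ x, 0 < x →
      HasDerivAt (fun t => ρ t lam + μ / 2 * t ^ 2) (deriv (fun t => ρ t lam) x + μ * x) x := by
    intro x hx
    have h1 := (hρ.diff lam hlam x hx.ne').hasDerivAt
    have h2 := (hasDerivAt_pow 2 x).const_mul (μ / 2)
    exact (h1.fun_add h2).congr_deriv (by norm_num; ring)
  have hc := (hρ.weak_convex lam hlam).subset (Set.subset_univ (Set.Ioi 0)) (convex_Ioi 0)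
  have h := hc.monotoneOn_deriv (fun x hx => (key x hx).differentiableAt) (a := s) (b := t)
    hs (hs.trans_le hst) hst
  rwa [(key s hs).deriv, (key t (hs.trans_le hst)).deriv] at h

/-- The derivative of the penalty, corrected by the weak convexity, stays above its limit at
`0`. -/
lemma sub_le_deriv (hρ : IsAmenable ρ g μ) (hlam : 0 < lam) {t : ℝ} (ht : 0 < t) :
    lam - μ * t ≤ deriv (fun t => ρ t lam) t := by
  have h1 : Tendsto (fun s => deriv (fun t => ρ t lam) s + μ * s) (𝓝[>] 0) (𝓝 (lam + μ * 0)) := by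
    refine (hρ.deriv_zero lam hlam).add ?_
    exact ((continuous_const.mul continuous_id).tendsto' 0 (μ * 0) rfl).mono_left
      nhdsWithin_le_nhds
  have h2 : ∀ᶠ s in 𝓝[>] (0 : ℝ), deriv (fun t => ρ t lam) s + μ * s
      ≤ deriv (fun t => ρ t lam) t + μ * t := by
    filter_upwards [Ioo_mem_nhdsGT ht] with s hs
    exact hρ.deriv_add_mono hlam hs.1 hs.2.le
  have := le_of_tendsto h1 h2
  linarith

/-- Averaging the two lower bounds `0` and `lam - μ t` for the derivative halves the cost `μ t²`
of the non-convexity. -/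
lemma half_le_deriv_mul (hρ : IsAmenable ρ g μ) (hlam : 0 < lam) {t : ℝ} (ht : 0 < t) :
    lam / 2 * t - μ / 2 * t ^ 2 ≤ deriv (fun t => ρ t lam) t * t := by
  have h1 := hρ.deriv_nonneg hlam ht
  have h2 := hρ.sub_le_deriv hlam ht
  nlinarith [mul_nonneg h1 ht.le, mul_le_mul_of_nonneg_right h2 ht.le]

end IsAmenable

lemma IsFlatAmenable.deriv_le {ρ : ℝ → ℝ → ℝ} {g : ℝ → ℝ} {μ δ lam : ℝ}
    (hρ : IsFlatAmenable ρ g μ δ) (hμ : 0 < μ) (hδ : 0 < δ) (hlam : 0 < lam) {t : ℝ}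
    (ht : 0 < t) : deriv (fun t => ρ t lam) t ≤ μ * δ * lam := by
  have hpos : 0 < μ * δ * lam := by positivity
  rcases le_or_gt (δ * lam) t with h | h
  · rw [hρ.flat lam hlam t h]
    exact hpos.le
  · have h1 := hρ.toIsAmenable.deriv_add_mono hlam ht h.le
    rw [hρ.flat lam hlam _ le_rfl] at h1
    nlinarith [mul_pos hμ ht]

/-! ### Norms of groups of coefficients -/

section Groups

variable {p J : ℕ} (grp : Fin p → Fin J)

/-- The inner product of the subvectors in group `j`. -/
def groupInner (a b : Vec p) (j : Fin J) : ℝ :=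
  ∑ m ∈ Finset.univ.filter (fun m => grp m = j), a m * b m

/-- The vector that agrees with `β` on group `j` and vanishes elsewhere. -/
def groupProj (β : Vec p) (j : Fin J) : Vec p :=
  WithLp.toLp 2 fun m => if grp m = j then β m else 0

lemma groupNorm_eq_norm (β : Vec p) (j : Fin J) : groupNorm grp β j = ‖groupProj grp β j‖ := by
  rw [EuclideanSpace.norm_eq, groupNorm, Finset.sum_filter]
  congr 1
  refine Finset.sum_congr rfl fun m _ => ?_
  by_cases h : grp m = j <;> simp [groupProj, h]

lemma groupProj_sub (a b : Vec p) (j : Fin J) :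
    groupProj grp (a - b) j = groupProj grp a j - groupProj grp b j := by
  ext m
  by_cases h : grp m = j <;> simp [groupProj, h]

lemma groupNorm_nonneg (β : Vec p) (j : Fin J) : 0 ≤ groupNorm grp β j := Real.sqrt_nonneg _

lemma groupNorm_sq (β : Vec p) (j : Fin J) : groupNorm grp β j ^ 2 =
    ∑ m ∈ Finset.univ.filter (fun m => grp m = j), β m ^ 2 :=
  Real.sq_sqrt (Finset.sum_nonneg fun _ _ => sq_nonneg _)

lemma groupNorm_sub_le (a b : Vec p) (j : Fin J) :
    groupNorm grp a j - groupNorm grp b j ≤ groupNorm grp (a - b) j := by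
  simp only [groupNorm_eq_norm, groupProj_sub]
  exact norm_sub_norm_le _ _

lemma norm_sq_eq_sum (β : Vec p) : ‖β‖ ^ 2 = ∑ j, groupNorm grp β j ^ 2 := by
  simp only [groupNorm_sq, EuclideanSpace.norm_sq_eq, Real.norm_eq_abs, sq_abs]
  exact (Finset.sum_fiberwise _ grp fun m => β m ^ 2).symm

lemma inner_eq_sum (a b : Vec p) : inner ℝ a b = ∑ m, a m * b m := by
  simp [PiLp.inner_apply, mul_comm]

lemma inner_eq_sum_groupInner (a b : Vec p) : inner ℝ a b = ∑ j, groupInner grp a b j := by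
  rw [inner_eq_sum]
  exact (Finset.sum_fiberwise _ grp fun m => a m * b m).symm

lemma groupNorm_le_norm (β : Vec p) (j : Fin J) : groupNorm grp β j ≤ ‖β‖ := by
  refine le_of_sq_le_sq ?_ (norm_nonneg _)
  rw [norm_sq_eq_sum grp]
  exact Finset.single_le_sum (f := fun j => groupNorm grp β j ^ 2)
    (fun j _ => sq_nonneg _) (Finset.mem_univ j)

lemma abs_groupInner_le (a b : Vec p) (j : Fin J) :
    |groupInner grp a b j| ≤ groupNorm grp a j * groupNorm grp b j := by
  refine abs_le_of_sq_le_sq ?_ (mul_nonneg (groupNorm_nonneg _ _ _) (groupNorm_nonneg _ _ _))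
  rw [mul_pow, groupNorm_sq, groupNorm_sq]
  exact Finset.sum_mul_sq_le_sq_mul_sq _ _ _

lemma groupInner_self (a : Vec p) (j : Fin J) : groupInner grp a a j = groupNorm grp a j ^ 2 := by
  rw [groupNorm_sq]
  exact Finset.sum_congr rfl fun m _ => by ring

lemma eq_zero_of_groupNorm {β : Vec p} {j : Fin J} (h : groupNorm grp β j = 0) {m : Fin p}
    (hm : grp m = j) : β m = 0 := by
  have h1 := groupNorm_sq grp β j
  rw [h, zero_pow two_ne_zero, eq_comm,
    Finset.sum_eq_zero_iff_of_nonneg fun _ _ => sq_nonneg _] at h1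
  exact pow_eq_zero_iff two_ne_zero |>.1 (h1 m (by simp [hm]))

lemma sum_abs_group_le (β : Vec p) (j : Fin J) :
    ∑ m ∈ Finset.univ.filter (fun m => grp m = j), |β m|
      ≤ Real.sqrt (groupSize grp j) * groupNorm grp β j := by
  rw [groupNorm, ← Real.sqrt_mul (Nat.cast_nonneg _)]
  refine Real.le_sqrt_of_sq_le ?_
  simpa [groupSize] using
    sq_sum_le_card_mul_sum_sq (s := Finset.univ.filter fun m => grp m = j) (f := fun m => |β m|)

/-- A vector whose coefficients are bounded by `c` has group norms at most `√d_j c`. -/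
lemma groupNorm_le_of_abs_le {β : Vec p} {c : ℝ} (hc : 0 ≤ c) {j : Fin J}
    (h : ∀ m, grp m = j → |β m| ≤ c) :
    groupNorm grp β j ≤ Real.sqrt (groupSize grp j) * c := by
  have h1 : Real.sqrt (groupSize grp j) * c = Real.sqrt (groupSize grp j * c ^ 2) := by
    rw [Real.sqrt_mul (Nat.cast_nonneg _), Real.sqrt_sq hc]
  rw [h1, groupNorm]
  refine Real.sqrt_le_sqrt ?_
  calc ∑ m ∈ Finset.univ.filter (fun m => grp m = j), β m ^ 2
      ≤ ∑ m ∈ Finset.univ.filter (fun m => grp m = j), c ^ 2 :=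
        Finset.sum_le_sum fun m hm => sq_le_sq' (abs_le.1 (h m (by simpa using hm))).1
          (abs_le.1 (h m (by simpa using hm))).2
    _ = groupSize grp j * c ^ 2 := by simp [groupSize]

lemma groupSize_le_maxSize (j : Fin J) : groupSize grp j ≤ maxSize grp :=
  le_ciSup (Set.finite_range _).bddAbove j

lemma groupSize_pos (hsurj : Function.Surjective grp) (j : Fin J) : 0 < groupSize grp j := by
  obtain ⟨m, hm⟩ := hsurj j
  exact Finset.card_pos.2 ⟨m, by simp [hm]⟩

lemma sizeRatio_pos (hsurj : Function.Surjective grp) (j : Fin J) : 0 < sizeRatio grp := by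
  have : Nonempty (Fin J) := ⟨j⟩
  have h1 : 0 < maxSize grp := (groupSize_pos grp hsurj j).trans_le (groupSize_le_maxSize grp j)
  have h2 : 0 < minSize grp := by
    obtain ⟨i, hi⟩ := exists_eq_ciInf_of_finite (f := groupSize grp)
    rw [minSize, ← hi]
    exact groupSize_pos grp hsurj i
  rw [sizeRatio]
  positivity

end Groups

/-! ### The `ℓ₁` norm -/

section L1

variable {p : ℕ}

lemma l1norm_add_le (a b : Vec p) : l1norm (a + b) ≤ l1norm a + l1norm b := by
  rw [l1norm, l1norm, l1norm, ← Finset.sum_add_distrib]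
  exact Finset.sum_le_sum fun m _ => abs_add_le _ _

lemma l1norm_smul (c : ℝ) (a : Vec p) : l1norm (c • a) = |c| * l1norm a := by
  simp [l1norm, abs_mul, Finset.mul_sum]

lemma sum_abs_le_sqrt_card (I : Finset (Fin p)) (β : Vec p) :
    (∑ m ∈ I, |β m|) ^ 2 ≤ I.card * ‖β‖ ^ 2 := by
  refine (sq_sum_le_card_mul_sum_sq (s := I) (f := fun m => |β m|)).trans ?_
  rw [EuclideanSpace.norm_sq_eq]
  gcongr
  simp only [Real.norm_eq_abs]
  exact Finset.sum_le_sum_of_subset_of_nonneg (Finset.subset_univ _) fun _ _ _ => sq_nonneg _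

lemma l1norm_eq_of_support {I : Finset (Fin p)} {β : Vec p} (h : ∀ m, m ∉ I → β m = 0) :
    l1norm β = ∑ m ∈ I, |β m| :=
  (Finset.sum_subset (Finset.subset_univ _) fun m _ hm => by simp [h m hm]).symm

lemma l1norm_sq_le {I : Finset (Fin p)} {β : Vec p} (h : ∀ m, m ∉ I → β m = 0) :
    l1norm β ^ 2 ≤ I.card * ‖β‖ ^ 2 := by
  rw [l1norm_eq_of_support h]
  exact sum_abs_le_sqrt_card I β

lemma abs_apply_le_norm (β : Vec p) (m : Fin p) : |β m| ≤ ‖β‖ := by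
  simpa using PiLp.norm_apply_le β m

lemma abs_inner_le_l1norm {I : Finset (Fin p)} {G β : Vec p} {c : ℝ}
    (hG : ∀ m ∈ I, |G m| ≤ c) (hβ : ∀ m, m ∉ I → β m = 0) :
    |inner ℝ G β| ≤ c * l1norm β := by
  rw [inner_eq_sum, l1norm, Finset.mul_sum]
  refine (Finset.abs_sum_le_sum_abs _ _).trans (Finset.sum_le_sum fun m _ => ?_)
  rw [abs_mul]
  by_cases hm : m ∈ I
  · exact mul_le_mul_of_nonneg_right (hG m hm) (abs_nonneg _)
  · simp [hβ m hm]

end L1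

/-! ### The gradient of the empirical loss -/

section Loss

variable {n p : ℕ} {l : ℝ → ℝ} {w v : Vec p → ℝ} {k₁ k₂ : ℝ}

/-- The gradient `-(1/n) ∑ i, w(x_i) l'((y_i - x_iᵀ β) v(x_i)) x_i` of the empirical loss. -/
noncomputable def lossGrad (l : ℝ → ℝ) (w v : Vec p → ℝ) (x : Fin n → Vec p) (y : Fin n → ℝ) (β : Vec p) :
    Vec p :=
  (-(1 / (n : ℝ))) • ∑ i, (w (x i) * deriv l ((y i - inner ℝ (x i) β) * v (x i))) • x i

lemma lossGrad_apply (x : Fin n → Vec p) (y : Fin n → ℝ) (β : Vec p) (m : Fin p) :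
    lossGrad l w v x y β m
      = -(1 / (n : ℝ)) * ∑ i, w (x i) * x i m
          * deriv l ((y i - inner ℝ (x i) β) * v (x i)) := by
  simp only [lossGrad, PiLp.smul_apply, WithLp.ofLp_sum, Finset.sum_apply, smul_eq_mul]
  congr 1
  refine Finset.sum_congr rfl fun i _ => ?_
  ring

lemma hasGradientAt_empLoss (hl : Differentiable ℝ l) (hv : ∀ x, 0 < v x)
    (x : Fin n → Vec p) (y : Fin n → ℝ) (β : Vec p) :
    HasGradientAt (empLoss l w v x y) (lossGrad l w v x y β) β := by
  rw [hasGradientAt_iff_hasFDerivAt]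
  have hterm : ∀ i, HasFDerivAt
      (fun β : Vec p => w (x i) / v (x i) * l ((y i - inner ℝ (x i) β) * v (x i)))
      (-(w (x i) * deriv l ((y i - inner ℝ (x i) β) * v (x i))) • innerSL ℝ (x i)) β := by
    intro i
    have h1 : HasFDerivAt (fun β : Vec p => (y i - inner ℝ (x i) β) * v (x i))
        (-(v (x i)) • innerSL ℝ (x i)) β := by
      have h2 := (((innerSL ℝ (x i)).hasFDerivAt (x := β)).const_sub (y i)).mul_const (v (x i))
      refine h2.congr_fderiv ?_
      ext z
      simp
    have h3 := ((hl _).hasDerivAt.comp_hasFDerivAt β h1).const_mul (w (x i) / v (x i))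
    refine h3.congr_fderiv ?_
    ext z
    have := (hv (x i)).ne'
    simp
    field_simp
  have hsum := (HasFDerivAt.fun_sum fun i (_ : i ∈ Finset.univ) => hterm i).const_mul
    (1 / (n : ℝ))
  refine hsum.congr_fderiv ?_
  ext z
  simp [lossGrad]

lemma gradient_empLoss (hl : Differentiable ℝ l) (hv : ∀ x, 0 < v x)
    (x : Fin n → Vec p) (y : Fin n → ℝ) (β : Vec p) :
    gradient (empLoss l w v x y) β = lossGrad l w v x y β :=
  (hasGradientAt_empLoss hl hv x y β).gradient

/-- The gradient of the empirical loss is Lipschitz from the `ℓ₁` to the `ℓ_∞` norm, with a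
constant given by the empirical second moments of the weighted covariates. -/
lemma abs_lossGrad_sub_le (hl : IsRobustLoss l k₁ k₂) (hk₂ : 0 < k₂) (hn : 0 < n) {B : ℝ}
    {x : Fin n → Vec p} {y : Fin n → ℝ}
    (hw : ∀ m, ∑ i, (w (x i) * x i m) ^ 2 ≤ n * B)
    (hv : ∀ m, ∑ i, (v (x i) * x i m) ^ 2 ≤ n * B) (a b : Vec p) (m : Fin p) :
    |lossGrad l w v x y b m - lossGrad l w v x y a m| ≤ k₂ * B * l1norm (b - a) := by
  have hn' : (0 : ℝ) < n := Nat.cast_pos.2 hn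
  have hpair : ∀ m', ∑ i, |w (x i) * x i m| * |v (x i) * x i m'| ≤ n * B := by
    intro m'
    calc ∑ i, |w (x i) * x i m| * |v (x i) * x i m'|
        ≤ ∑ i, ((w (x i) * x i m) ^ 2 / 2 + (v (x i) * x i m') ^ 2 / 2) := by
          refine Finset.sum_le_sum fun i _ => ?_
          nlinarith [sq_nonneg (|w (x i) * x i m| - |v (x i) * x i m'|),
            sq_abs (w (x i) * x i m), sq_abs (v (x i) * x i m')]
      _ ≤ n * B := by
          rw [Finset.sum_add_distrib, ← Finset.sum_div, ← Finset.sum_div]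
          linarith [hw m, hv m']
  have hterm : ∀ i, |w (x i) * x i m * deriv l ((y i - inner ℝ (x i) b) * v (x i))
      - w (x i) * x i m * deriv l ((y i - inner ℝ (x i) a) * v (x i))|
      ≤ k₂ * ∑ m', |(b - a) m'| * (|w (x i) * x i m| * |v (x i) * x i m'|) := by
    intro i
    rw [← mul_sub, abs_mul]
    have h1 := hl.lipschitz ((y i - inner ℝ (x i) b) * v (x i))
      ((y i - inner ℝ (x i) a) * v (x i))
    have h2 : |(y i - inner ℝ (x i) b) * v (x i) - (y i - inner ℝ (x i) a) * v (x i)|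
        ≤ ∑ m', |(b - a) m'| * |v (x i) * x i m'| := by
      have h3 : (y i - inner ℝ (x i) b) * v (x i) - (y i - inner ℝ (x i) a) * v (x i)
          = -∑ m', (b - a) m' * (v (x i) * x i m') := by
        have h4 : inner ℝ (x i) (b - a) = ∑ m', x i m' * (b - a) m' := inner_eq_sum _ _
        rw [inner_sub_right] at h4
        have h5 : ∑ m', (b - a) m' * (v (x i) * x i m')
            = v (x i) * ∑ m', x i m' * (b - a) m' := by
          rw [Finset.mul_sum]
          exact Finset.sum_congr rfl fun m' _ => by ring
        rw [h5, ← h4]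
        ring
      rw [h3, abs_neg]
      refine (Finset.abs_sum_le_sum_abs _ _).trans (le_of_eq ?_)
      exact Finset.sum_congr rfl fun m' _ => abs_mul _ _
    calc |w (x i) * x i m| * |deriv l ((y i - inner ℝ (x i) b) * v (x i))
          - deriv l ((y i - inner ℝ (x i) a) * v (x i))|
        ≤ |w (x i) * x i m| * (k₂ * ∑ m', |(b - a) m'| * |v (x i) * x i m'|) :=
          mul_le_mul_of_nonneg_left (h1.trans (mul_le_mul_of_nonneg_left h2 hk₂.le))
            (abs_nonneg _)
      _ = k₂ * ∑ m', |(b - a) m'| * (|w (x i) * x i m| * |v (x i) * x i m'|) := by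
          rw [mul_left_comm, Finset.mul_sum]
          congr 1
          exact Finset.sum_congr rfl fun m' _ => by ring
  rw [lossGrad_apply, lossGrad_apply, ← mul_sub, ← Finset.sum_sub_distrib, abs_mul, abs_neg,
    abs_of_pos (by positivity : 0 < 1 / (n : ℝ)), one_div, inv_mul_le_iff₀ hn']
  calc |∑ i, (w (x i) * x i m * deriv l ((y i - inner ℝ (x i) b) * v (x i))
        - w (x i) * x i m * deriv l ((y i - inner ℝ (x i) a) * v (x i)))|
      ≤ ∑ i, k₂ * ∑ m', |(b - a) m'| * (|w (x i) * x i m| * |v (x i) * x i m'|) :=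
        (Finset.abs_sum_le_sum_abs _ _).trans (Finset.sum_le_sum fun i _ => hterm i)
    _ = k₂ * ∑ m', |(b - a) m'| * ∑ i, |w (x i) * x i m| * |v (x i) * x i m'| := by
        rw [← Finset.mul_sum, Finset.sum_comm]
        simp only [Finset.mul_sum]
    _ ≤ k₂ * ∑ m', |(b - a) m'| * (n * B) := by
        refine mul_le_mul_of_nonneg_left (Finset.sum_le_sum fun m' _ => ?_) hk₂.le
        exact mul_le_mul_of_nonneg_left (hpair m') (abs_nonneg _)
    _ = n * (k₂ * B * l1norm (b - a)) := by
        rw [← Finset.sum_mul, l1norm]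
        ring

end Loss

/-! ### The oracle estimator under restricted strong convexity -/

section Oracle

variable {n p : ℕ} {L : Vec p → ℝ} {I : Finset (Fin p)} {βs : Vec p} {γ τ r : ℝ}

/-- The feasible set of the oracle program. -/
def oracleSet (I : Finset (Fin p)) (βs : Vec p) (r : ℝ) : Set (Vec p) :=
  {β | (∀ m, m ∉ I → β m = 0) ∧ ‖β - βs‖ ≤ r}

lemma convex_oracleSet : Convex ℝ (oracleSet I βs r) := by
  intro a ha b hb s t hs ht hst
  refine ⟨fun m hm => by simp [ha.1 m hm, hb.1 m hm], ?_⟩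
  have h := convex_closedBall βs r (x := a) (y := b) (by simpa [dist_eq_norm] using ha.2)
    (by simpa [dist_eq_norm] using hb.2) hs ht hst
  simpa [dist_eq_norm] using h

lemma isCompact_oracleSet : IsCompact (oracleSet I βs r) := by
  have h1 : IsClosed {β : Vec p | ∀ m, m ∉ I → β m = 0} := by
    simp only [Set.ofPred_forall]
    refine isClosed_iInter fun m => isClosed_iInter fun _ => ?_
    exact isClosed_eq (by fun_prop) continuous_const
  refine ((isCompact_closedBall βs r).inter_left h1).of_isClosed_subset ?_ ?_
  · exact h1.inter (isClosed_le (continuous_id.sub continuous_const).norm continuous_const)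
  · exact fun β hβ => ⟨hβ.1, by simpa [dist_eq_norm] using hβ.2⟩

lemma exists_isOracle (hL : Differentiable ℝ L) (hr : 0 ≤ r) (hβs : ∀ m, m ∉ I → βs m = 0) :
    ∃ βo, IsOracle L I βs r βo := by
  obtain ⟨βo, h1, h2⟩ := (isCompact_oracleSet (I := I) (βs := βs) (r := r)).exists_isMinOn
    ⟨βs, hβs, by simpa using hr⟩ hL.continuous.continuousOn
  exact ⟨βo, h1, fun β' h3 h4 => h2 ⟨h3, h4⟩⟩

lemma IsOracle.inner_gradient_nonneg (hL : Differentiable ℝ L) {βo β' : Vec p}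
    (h : IsOracle L I βs r βo) (h1 : ∀ m, m ∉ I → β' m = 0) (h2 : ‖β' - βs‖ ≤ r) :
    0 ≤ inner ℝ (gradient L βo) (β' - βo) := by
  have hmin : IsLocalMinOn L (oracleSet I βs r) βo :=
    IsMinOn.localize fun β hβ => h.2 β hβ.1 hβ.2
  rw [inner_gradient_left]
  refine hmin.hasFDerivWithinAt_nonneg (hL βo).hasFDerivAt.hasFDerivWithinAt ?_
  exact sub_mem_posTangentConeAt_of_segment_subset
    (convex_oracleSet.segment_subset h.1 ⟨h1, h2⟩)

/-- On vectors with the support of the oracle, restricted strong convexity is plain strong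
convexity. -/
lemma RSC.strong_convex (h : RSC n L βs γ τ r) (hτ : 0 ≤ τ * (Real.log p / n))
    (hk : τ * (Real.log p / n) * I.card ≤ γ / 2) {b₁ b₂ : Vec p}
    (hb₁ : ∀ m, m ∉ I → b₁ m = 0) (hb₂ : ∀ m, m ∉ I → b₂ m = 0)
    (h₁ : ‖b₁ - βs‖ ≤ r) (h₂ : ‖b₂ - βs‖ ≤ r) :
    γ / 2 * ‖b₁ - b₂‖ ^ 2 ≤ inner ℝ (gradient L b₁ - gradient L b₂) (b₁ - b₂) := by
  refine le_trans ?_ (h b₁ b₂ h₁ h₂)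
  have h3 : l1norm (b₁ - b₂) ^ 2 ≤ I.card * ‖b₁ - b₂‖ ^ 2 :=
    l1norm_sq_le fun m hm => by simp [hb₁ m hm, hb₂ m hm]
  have h4 := mul_le_mul_of_nonneg_left h3 hτ
  have h5 := mul_le_mul_of_nonneg_right hk (sq_nonneg ‖b₁ - b₂‖)
  linarith

lemma IsOracle.unique (hL : Differentiable ℝ L) (h : RSC n L βs γ τ r) (hγ : 0 < γ)
    (hτ : 0 ≤ τ * (Real.log p / n)) (hk : τ * (Real.log p / n) * I.card ≤ γ / 2)
    {b₁ b₂ : Vec p} (h₁ : IsOracle L I βs r b₁) (h₂ : IsOracle L I βs r b₂) : b₁ = b₂ := by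
  have h3 := h.strong_convex hτ hk h₁.1.1 h₂.1.1 h₁.1.2 h₂.1.2
  have h4 := h₁.inner_gradient_nonneg hL h₂.1.1 h₂.1.2
  have h5 := h₂.inner_gradient_nonneg hL h₁.1.1 h₁.1.2
  rw [← neg_sub b₁ b₂, inner_neg_right] at h4
  rw [inner_sub_left] at h3
  have h6 : ‖b₁ - b₂‖ ^ 2 ≤ 0 := by
    by_contra! hpos
    nlinarith
  have h7 : ‖b₁ - b₂‖ = 0 := pow_eq_zero_iff two_ne_zero |>.1 (le_antisymm h6 (sq_nonneg _))
  exact sub_eq_zero.1 (norm_eq_zero.1 h7)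

/-- If the gradient of the loss at the true vector is at most `A / k` on the `k` coefficients
of the support, then the error of the oracle is at most `(2 A / γ) / √k`. -/
lemma IsOracle.norm_sub_le (hL : Differentiable ℝ L) (h : RSC n L βs γ τ r) (hγ : 0 < γ)
    (hr : 0 ≤ r)
    (hτ : 0 ≤ τ * (Real.log p / n)) (hk : τ * (Real.log p / n) * I.card ≤ γ / 2)
    (hI : 0 < I.card) (hβs : ∀ m, m ∉ I → βs m = 0) {A : ℝ} (hA : 0 ≤ A)
    (hG : ∀ m ∈ I, |gradient L βs m| ≤ A / I.card)
    {βo : Vec p} (ho : IsOracle L I βs r βo) :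
    ‖βo - βs‖ ≤ 2 * A / γ / Real.sqrt I.card := by
  have h3 := h.strong_convex hτ hk ho.1.1 hβs ho.1.2 (by simpa using hr)
  have h4 := ho.inner_gradient_nonneg hL hβs (by simpa using hr)
  rw [← neg_sub βo βs, inner_neg_right] at h4
  rw [inner_sub_left] at h3
  have hsupp : ∀ m, m ∉ I → (βo - βs) m = 0 := fun m hm => by simp [ho.1.1 m hm, hβs m hm]
  have h5 := neg_le_of_abs_le (abs_inner_le_l1norm hG hsupp)
  have hk0 : (0 : ℝ) < I.card := Nat.cast_pos.2 hI
  have hs : 0 < Real.sqrt I.card := Real.sqrt_pos.2 hk0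
  have hss : Real.sqrt I.card ^ 2 = I.card := Real.sq_sqrt hk0.le
  have h6 : l1norm (βo - βs) ≤ Real.sqrt I.card * ‖βo - βs‖ := by
    refine le_of_sq_le_sq ?_ (by positivity)
    rw [mul_pow, hss]
    exact l1norm_sq_le hsupp
  have h7 : A / I.card * l1norm (βo - βs) ≤ A / Real.sqrt I.card * ‖βo - βs‖ := by
    calc A / I.card * l1norm (βo - βs)
        ≤ A / I.card * (Real.sqrt I.card * ‖βo - βs‖) :=
          mul_le_mul_of_nonneg_left h6 (by positivity)
      _ = A / Real.sqrt I.card * ‖βo - βs‖ := by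
          rw [← mul_assoc]
          congr 1
          rw [← hss, Real.sqrt_sq hs.le]
          field_simp
  have h8 : γ / 2 * ‖βo - βs‖ ^ 2 ≤ A / Real.sqrt I.card * ‖βo - βs‖ := by linarith
  rcases (norm_nonneg (βo - βs)).eq_or_lt with h0 | h0
  · rw [← h0]
    positivity
  · have h9 : γ / 2 * ‖βo - βs‖ ≤ A / Real.sqrt I.card := by
      refine le_of_mul_le_mul_right ?_ h0
      linarith
    calc ‖βo - βs‖ = 2 / γ * (γ / 2 * ‖βo - βs‖) := by field_simp
      _ ≤ 2 / γ * (A / Real.sqrt I.card) := mul_le_mul_of_nonneg_left h9 (by positivity)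
      _ = 2 * A / γ / Real.sqrt I.card := by ring

/-- An oracle in the interior of the ball is a critical point in the coefficients of its
support. -/
lemma IsOracle.gradient_eq_zero (hL : Differentiable ℝ L) {βo : Vec p}
    (ho : IsOracle L I βs r βo) (hlt : ‖βo - βs‖ < r) {m : Fin p} (hm : m ∈ I) :
    gradient L βo m = 0 := by
  set G := gradient L βo with hG
  set e : Vec p := EuclideanSpace.single m (1 : ℝ) with he
  obtain ⟨t, ht, htr⟩ : ∃ t : ℝ, 0 < t ∧ ‖(t * G m) • e‖ ≤ r - ‖βo - βs‖ := by
    refine ⟨(r - ‖βo - βs‖) / (|G m| + 1), div_pos (by linarith) (by positivity), ?_⟩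
    rw [norm_smul, he, PiLp.norm_single, norm_one, mul_one, Real.norm_eq_abs, abs_mul,
      abs_of_pos (div_pos (sub_pos.2 hlt) (by positivity)), div_mul_eq_mul_div,
      div_le_iff₀ (by positivity)]
    exact mul_le_mul_of_nonneg_left (by linarith) (by linarith)
  have h := ho.inner_gradient_nonneg hL (β' := βo - (t * G m) • e) ?_ ?_
  · rw [sub_sub_cancel_left, inner_neg_right, inner_smul_right, he,
      EuclideanSpace.inner_single_right] at h
    simp only [conj_trivial, one_mul] at h
    have h1 : t * (G m * G m) ≤ 0 := by linarith
    have h2 : G m * G m ≤ 0 := by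
      by_contra! hpos
      nlinarith
    exact mul_self_eq_zero.1 (le_antisymm h2 (mul_self_nonneg _))
  · intro m' hm'
    have : m' ≠ m := fun h => hm' (h ▸ hm)
    simp [ho.1.1 m' hm', he, this]
  · calc ‖βo - (t * G m) • e - βs‖ = ‖βo - βs - (t * G m) • e‖ := by congr 1; abel
      _ ≤ ‖βo - βs‖ + ‖(t * G m) • e‖ := _root_.norm_sub_le _ _
      _ ≤ r := by linarith

end Oracle

/-! ### Stationary points of the penalized program -/

section Stationary

variable {n p J : ℕ} {grp : Fin p → Fin J} {S : Finset (Fin J)} {L : Vec p → ℝ}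
  {βs βo : Vec p} {ρ : ℝ → ℝ → ℝ} {g : ℝ → ℝ} {γ τ μ δ r lam R : ℝ}

/-- If the oracle is large on the groups in `S`, a critical point there, and has a small gradient
elsewhere, then it is a stationary point: minus its gradient is a penalty gradient. -/
lemma isStationary_of_critical (hρ : IsFlatAmenable ρ g μ δ)
    (hsurj : Function.Surjective grp) (hlam : 0 < lam)
    (hsupp : ∀ m, grp m ∉ S → βo m = 0) (hR : l1norm βo ≤ R)
    (hcrit : ∀ m, grp m ∈ S → gradient L βo m = 0)
    (hdual : ∀ m, |gradient L βo m| ≤ lam)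
    (hbig : ∀ j ∈ S, δ * (Real.sqrt (groupSize grp j) * lam) ≤ groupNorm grp βo j) :
    IsStationary L grp ρ lam R βo := by
  refine ⟨hR, -gradient L βo, fun j => ⟨fun hj m hm => ?_, fun hj => ?_⟩, ?_⟩
  · have hjS : j ∈ S := by
      by_contra hjS
      refine hj ?_
      rw [groupNorm, Finset.sum_eq_zero, Real.sqrt_zero]
      intro m' hm'
      rw [hsupp m' (by rwa [(Finset.mem_filter.1 hm').2])]
      norm_num
    have hsize : (0 : ℝ) < groupSize grp j := Nat.cast_pos.2 (groupSize_pos grp hsurj j)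
    rw [hρ.flat _ (by positivity) _ (hbig j hjS), PiLp.neg_apply, hcrit m (hm ▸ hjS)]
    simp
  · exact groupNorm_le_of_abs_le grp hlam.le fun m _ => by simpa using hdual m
  · exact Eventually.of_forall fun β' _ => by simp

/-- Stationarity is a variational inequality over the whole `ℓ₁` ball, by its convexity. -/
lemma IsStationary.exists_inner_nonneg {β : Vec p} (h : IsStationary L grp ρ lam R β) :
    ∃ u, IsPenaltyGradient grp ρ lam β u ∧
      ∀ β', l1norm β' ≤ R → 0 ≤ inner ℝ (gradient L β + u) (β' - β) := by
  obtain ⟨hβ, u, hu, hev⟩ := h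
  refine ⟨u, hu, fun β' hβ' => ?_⟩
  have hc : Tendsto (fun t : ℝ => β + t • (β' - β)) (𝓝[>] 0) (𝓝 β) := by
    have : Continuous fun t : ℝ => β + t • (β' - β) := by fun_prop
    exact (this.tendsto' 0 β (by simp)).mono_left nhdsWithin_le_nhds
  obtain ⟨t, ht, ht0, ht1⟩ := ((hc.eventually hev).and (Ioo_mem_nhdsGT one_pos)).exists
  have hfeas : l1norm (β + t • (β' - β)) ≤ R := by
    have h1 : β + t • (β' - β) = (1 - t) • β + t • β' := by module
    rw [h1]
    refine (l1norm_add_le _ _).trans ?_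
    rw [l1norm_smul, l1norm_smul, abs_of_pos ht0, abs_of_pos (sub_pos.2 ht1)]
    nlinarith
  have h2 := ht hfeas
  rw [add_sub_cancel_left, inner_smul_right] at h2
  exact nonneg_of_mul_nonneg_right h2 ht0

/-- Outside `S`, where the oracle vanishes, a penalty gradient at `β` pays for the `ℓ₁` norm of
`β`, at the price of half of the weak convexity. -/
lemma IsPenaltyGradient.le_groupInner_self (hρ : IsAmenable ρ g μ) (hsurj : Function.Surjective grp)
    (hlam : 0 < lam) {β u : Vec p} (hu : IsPenaltyGradient grp ρ lam β u) (j : Fin J) :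
    lam / 2 * ∑ m ∈ Finset.univ.filter (fun m => grp m = j), |β m|
      - μ / 2 * groupNorm grp β j ^ 2 ≤ groupInner grp u β j := by
  have hsum := sum_abs_group_le grp β j
  rcases (groupNorm_nonneg grp β j).eq_or_lt with h0 | h0
  · have hz : ∀ m ∈ Finset.univ.filter (fun m => grp m = j), β m = 0 := fun m hm =>
      eq_zero_of_groupNorm grp h0.symm (Finset.mem_filter.1 hm).2
    have e1 : ∑ m ∈ Finset.univ.filter (fun m => grp m = j), |β m| = 0 :=
      Finset.sum_eq_zero fun m hm => by rw [hz m hm, abs_zero]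
    have e2 : groupInner grp u β j = 0 :=
      Finset.sum_eq_zero fun m hm => by rw [hz m hm, mul_zero]
    rw [e1, e2, ← h0]
    simp
  · set lj := Real.sqrt (groupSize grp j) * lam with hlj
    have hsize : (0 : ℝ) < groupSize grp j := Nat.cast_pos.2 (groupSize_pos grp hsurj j)
    have hljpos : 0 < lj := by positivity
    have hin : groupInner grp u β j
        = deriv (fun t => ρ t lj) (groupNorm grp β j) * groupNorm grp β j := by
      set t := groupNorm grp β j with ht
      have h1 : groupInner grp u β j
          = deriv (fun t => ρ t lj) t / t * groupInner grp β β j := by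
        rw [groupInner, groupInner, Finset.mul_sum]
        refine Finset.sum_congr rfl fun m hm => ?_
        rw [(hu j).1 h0.ne' m (Finset.mem_filter.1 hm).2]
        ring
      rw [h1, groupInner_self, ← ht]
      field_simp
    have h2 := hρ.half_le_deriv_mul hljpos h0
    rw [hin]
    have h3 := mul_le_mul_of_nonneg_left hsum (half_pos hlam).le
    have h4 : lam / 2 * (Real.sqrt (groupSize grp j) * groupNorm grp β j)
        = lj / 2 * groupNorm grp β j := by rw [hlj]; ring
    linarith

/-- A group on which the penalty gradient does not vanish has `‖β_j‖ < δ λ_j`, so it is far from a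
group `β'_j` with `‖β'_j‖ ≥ (δ + M) λ_j`; the bound `max 1 (μ δ) λ_j` for the penalty gradient
then makes its contribution quadratic in the distance. -/
lemma IsPenaltyGradient.neg_groupInner_le (hρ : IsFlatAmenable ρ g μ δ) (hμ : 0 < μ) (hδ : 0 < δ)
    (hsurj : Function.Surjective grp) (hlam : 0 < lam) {β β' u : Vec p}
    (hu : IsPenaltyGradient grp ρ lam β u) (j : Fin J) {M : ℝ} (hM : 0 < M)
    (hbig : (δ + M) * (Real.sqrt (groupSize grp j) * lam) ≤ groupNorm grp β' j) :
    -groupInner grp u (β - β') j ≤ max 1 (μ * δ) / M * groupNorm grp (β - β') j ^ 2 := by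
  set lj := Real.sqrt (groupSize grp j) * lam with hlj
  have hsize : (0 : ℝ) < groupSize grp j := Nat.cast_pos.2 (groupSize_pos grp hsurj j)
  have hljpos : 0 < lj := by positivity
  have hc : 0 < max 1 (μ * δ) := lt_max_of_lt_left one_pos
  have hfar : groupNorm grp β' j - groupNorm grp β j ≤ groupNorm grp (β - β') j := by
    refine (groupNorm_sub_le grp β' β j).trans (le_of_eq ?_)
    rw [groupNorm_eq_norm, groupNorm_eq_norm, groupProj_sub, groupProj_sub, norm_sub_rev]
  -- the contribution of a penalty gradient that is bounded by `max 1 (μ δ) λ_j`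
  have key : groupNorm grp β j ≤ δ * lj → groupNorm grp u j ≤ max 1 (μ * δ) * lj →
      -groupInner grp u (β - β') j ≤ max 1 (μ * δ) / M * groupNorm grp (β - β') j ^ 2 := by
    intro hsmall hubd
    have h1 : M * lj ≤ groupNorm grp (β - β') j := by nlinarith
    have h2 := groupNorm_nonneg grp (β - β') j
    calc -groupInner grp u (β - β') j
        ≤ groupNorm grp u j * groupNorm grp (β - β') j :=
          (neg_le_abs _).trans (abs_groupInner_le grp _ _ j)
      _ ≤ max 1 (μ * δ) * lj * groupNorm grp (β - β') j := mul_le_mul_of_nonneg_right hubd h2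
      _ = max 1 (μ * δ) / M * (M * lj * groupNorm grp (β - β') j) := by field_simp
      _ ≤ max 1 (μ * δ) / M * groupNorm grp (β - β') j ^ 2 := by
          refine mul_le_mul_of_nonneg_left ?_ (by positivity)
          rw [sq]
          exact mul_le_mul_of_nonneg_right h1 h2
  rcases (groupNorm_nonneg grp β j).eq_or_lt with h0 | h0
  · refine key (by rw [← h0]; positivity) (((hu j).2 h0.symm).trans ?_)
    exact le_mul_of_one_le_left hljpos.le (le_max_left _ _)
  set t := groupNorm grp β j with ht
  rcases le_or_gt (δ * lj) t with hflat | hflat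
  · have hz : groupInner grp u (β - β') j = 0 := by
      refine Finset.sum_eq_zero fun m hm => ?_
      rw [(hu j).1 h0.ne' m (Finset.mem_filter.1 hm).2, ← hlj, ← ht, hρ.flat lj hljpos t hflat]
      ring
    rw [hz, neg_zero]
    positivity
  · refine key hflat.le ?_
    have hd0 := hρ.toIsAmenable.deriv_nonneg hljpos h0
    have hun : groupNorm grp u j = deriv (fun t => ρ t lj) t := by
      refine (pow_left_inj₀ (groupNorm_nonneg _ _ _) hd0 two_ne_zero).1 ?_
      have h1 : groupNorm grp u j ^ 2
          = (deriv (fun t => ρ t lj) t / t) ^ 2 * groupNorm grp β j ^ 2 := by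
        rw [groupNorm_sq, groupNorm_sq, Finset.mul_sum]
        refine Finset.sum_congr rfl fun m hm => ?_
        rw [(hu j).1 h0.ne' m (Finset.mem_filter.1 hm).2]
        ring
      rw [h1, ← ht]
      field_simp
    rw [hun]
    exact (hρ.deriv_le hμ hδ hljpos h0).trans
      (mul_le_mul_of_nonneg_right (le_max_right _ _) hljpos.le)

/-- Every stationary point in the region of restricted strong convexity is the oracle. -/
lemma IsStationary.eq_of_critical (hρ : IsFlatAmenable ρ g μ δ) (hμ : 0 < μ) (hδ : 0 < δ)
    (hγ : 0 < γ) (hγμ : 3 / 4 * μ < γ) (hsurj : Function.Surjective grp) (hlam : 0 < lam)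
    (hRSC : RSC n L βs γ τ r) (hτ : 0 ≤ τ * (Real.log p / n))
    (hk : τ * (Real.log p / n) * (groupIndices grp S).card ≤ γ / 8)
    (hRlam : 8 * (τ * (Real.log p / n)) * R ≤ lam)
    (hor : ‖βo - βs‖ ≤ r) (hsupp : ∀ m, grp m ∉ S → βo m = 0) (hR : l1norm βo ≤ R)
    (hcrit : ∀ m, grp m ∈ S → gradient L βo m = 0)
    (hdual : ∀ m, |gradient L βo m| ≤ lam / 4)
    (hbig : ∀ j ∈ S, (δ + 4 * max 1 (μ * δ) / γ) * (Real.sqrt (groupSize grp j) * lam)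
      ≤ groupNorm grp βo j)
    {β : Vec p} (hβ : IsStationary L grp ρ lam R β) (hβr : ‖β - βs‖ ≤ r) : β = βo := by
  obtain ⟨u, hu, hvar⟩ := hβ.exists_inner_nonneg
  have hc : 0 < max 1 (μ * δ) := lt_max_of_lt_left one_pos
  set h := β - βo with hh
  set c := τ * (Real.log p / n) with hcdef
  -- the `ℓ₁` norm of `h` off the groups in `S`, and the split of the squared norm
  set V := ∑ j ∈ Finset.univ.filter (· ∉ S),
    ∑ m ∈ Finset.univ.filter (fun m => grp m = j), |h m| with hV
  set N₁ := ∑ j ∈ S, groupNorm grp h j ^ 2 with hN₁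
  set N₂ := ∑ j ∈ Finset.univ.filter (· ∉ S), groupNorm grp h j ^ 2 with hN₂
  have hsplit : ∀ f : Fin J → ℝ, ∑ j, f j = ∑ j ∈ S, f j + ∑ j ∈ Finset.univ.filter (· ∉ S), f j := by
    intro f
    rw [← Finset.sum_filter_add_sum_filter_not Finset.univ (· ∈ S)]
    simp
  have hnorm : ‖h‖ ^ 2 = N₁ + N₂ := by rw [norm_sq_eq_sum grp, hsplit]
  have hoff : ∀ j, j ∉ S → ∀ m, grp m = j → h m = β m := by
    intro j hj m hm
    simp [hh, hsupp m (hm ▸ hj)]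
  have hV0 : 0 ≤ V := Finset.sum_nonneg fun _ _ => Finset.sum_nonneg fun _ _ => abs_nonneg _
  have hN₁0 : 0 ≤ N₁ := Finset.sum_nonneg fun _ _ => sq_nonneg _
  have hN₂0 : 0 ≤ N₂ := Finset.sum_nonneg fun _ _ => sq_nonneg _
  have hVR : V ≤ R := by
    refine le_trans ?_ hβ.1
    rw [l1norm, ← Finset.sum_fiberwise Finset.univ grp fun m => |β m|, hsplit]
    refine le_add_of_nonneg_of_le
      (Finset.sum_nonneg fun _ _ => Finset.sum_nonneg fun _ _ => abs_nonneg _) (le_of_eq ?_)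
    refine Finset.sum_congr rfl fun j hj => Finset.sum_congr rfl fun m hm => ?_
    rw [hoff j (Finset.mem_filter.1 hj).2 m (Finset.mem_filter.1 hm).2]
  -- the `ℓ₁` norm on the groups in `S`
  have hl1 : l1norm h ^ 2 ≤ 2 * ((groupIndices grp S).card * N₁) + 2 * V ^ 2 := by
    set T := ∑ j ∈ S, ∑ m ∈ Finset.univ.filter (fun m => grp m = j), |h m| with hT
    have h1 : l1norm h = T + V := by
      rw [l1norm, ← Finset.sum_fiberwise Finset.univ grp fun m => |h m|, hsplit]
    have h2 : ∀ f : Fin p → ℝ, ∑ j ∈ S, ∑ m ∈ Finset.univ.filter (fun m => grp m = j), f m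
        = ∑ m ∈ groupIndices grp S, f m := by
      intro f
      rw [groupIndices, ← Finset.sum_fiberwise_of_maps_to (t := S) (g := grp)
        (fun m hm => (Finset.mem_filter.1 hm).2)]
      refine Finset.sum_congr rfl fun j hj => Finset.sum_congr ?_ fun _ _ => rfl
      ext m
      simp only [Finset.mem_filter, Finset.mem_univ, true_and]
      exact ⟨fun hm => ⟨hm ▸ hj, hm⟩, fun hm => hm.2⟩
    have h3 : T ^ 2 ≤ (groupIndices grp S).card * N₁ := by
      have h4 : N₁ = ∑ m ∈ groupIndices grp S, |h m| ^ 2 := by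
        rw [hN₁, ← h2]
        exact Finset.sum_congr rfl fun j _ => by simp only [groupNorm_sq, sq_abs]
      rw [h4, hT, h2]
      exact sq_sum_le_card_mul_sum_sq
    rw [h1]
    nlinarith [sq_nonneg (T - V)]
  -- the loss at the oracle contributes only off the groups in `S`
  have hloss : -inner ℝ (gradient L βo) h ≤ lam / 4 * V := by
    have h1 : ∀ j ∈ S, groupInner grp (gradient L βo) h j = 0 := fun j hj =>
      Finset.sum_eq_zero fun m hm => by
        rw [hcrit m ((Finset.mem_filter.1 hm).2 ▸ hj), zero_mul]
    rw [inner_eq_sum_groupInner grp, hsplit, Finset.sum_eq_zero h1, zero_add,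
      ← Finset.sum_neg_distrib, hV, Finset.mul_sum]
    refine Finset.sum_le_sum fun j _ => ?_
    rw [groupInner, ← Finset.sum_neg_distrib, Finset.mul_sum]
    refine Finset.sum_le_sum fun m _ => (neg_le_abs _).trans ?_
    rw [abs_mul]
    exact mul_le_mul_of_nonneg_right (hdual m) (abs_nonneg _)
  -- the penalty contributes
  have hpen : -inner ℝ u h ≤ γ / 4 * N₁ - lam / 2 * V + μ / 2 * N₂ := by
    have hM : max 1 (μ * δ) / (4 * max 1 (μ * δ) / γ) = γ / 4 := by field_simp
    have hS : ∑ j ∈ S, -groupInner grp u h j ≤ γ / 4 * N₁ := by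
      rw [hN₁, Finset.mul_sum]
      refine Finset.sum_le_sum fun j hj => ?_
      rw [← hM]
      exact hu.neg_groupInner_le hρ hμ hδ hsurj hlam j (by positivity) (hbig j hj)
    have hSc : lam / 2 * V - μ / 2 * N₂
        ≤ ∑ j ∈ Finset.univ.filter (· ∉ S), groupInner grp u h j := by
      rw [hV, hN₂, Finset.mul_sum, Finset.mul_sum, ← Finset.sum_sub_distrib]
      refine Finset.sum_le_sum fun j hj => ?_
      have hz := hoff j (Finset.mem_filter.1 hj).2
      have h1 := hu.le_groupInner_self hρ.toIsAmenable hsurj hlam j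
      have h2 : ∀ m ∈ Finset.univ.filter (fun m => grp m = j), h m = β m := fun m hm =>
        hz m (Finset.mem_filter.1 hm).2
      rw [groupNorm_sq] at h1 ⊢
      rw [groupInner] at h1 ⊢
      have e1 : ∑ m ∈ Finset.univ.filter (fun m => grp m = j), |h m|
          = ∑ m ∈ Finset.univ.filter (fun m => grp m = j), |β m| :=
        Finset.sum_congr rfl fun m hm => by rw [h2 m hm]
      have e2 : ∑ m ∈ Finset.univ.filter (fun m => grp m = j), h m ^ 2
          = ∑ m ∈ Finset.univ.filter (fun m => grp m = j), β m ^ 2 :=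
        Finset.sum_congr rfl fun m hm => by rw [h2 m hm]
      have e3 : ∑ m ∈ Finset.univ.filter (fun m => grp m = j), u m * h m
          = ∑ m ∈ Finset.univ.filter (fun m => grp m = j), u m * β m :=
        Finset.sum_congr rfl fun m hm => by rw [h2 m hm]
      rw [e1, e2, e3]
      exact h1
    rw [Finset.sum_neg_distrib] at hS
    rw [inner_eq_sum_groupInner grp, hsplit]
    linarith
  have hstat : inner ℝ (gradient L β) h ≤ -inner ℝ u h := by
    have h1 := hvar βo hR
    rw [← neg_sub β βo, ← hh, inner_neg_right, inner_add_left] at h1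
    linarith
  have hmain := hRSC β βo hβr hor
  rw [inner_sub_left, ← hh, ← hcdef, hnorm] at hmain
  have h1 := mul_le_mul_of_nonneg_left hl1 hτ
  have h2 := mul_le_mul_of_nonneg_right hk hN₁0
  have h3 : 8 * (c * V ^ 2) ≤ lam * V := by
    have h4 : 8 * c * V ≤ lam :=
      (mul_le_mul_of_nonneg_left hVR (by linarith)).trans hRlam
    nlinarith
  have h4 : γ / 2 * N₁ + (γ - μ / 2) * N₂ ≤ 0 := by linarith
  have hγ' : 0 < γ - μ / 2 := by linarith
  have h5 : N₁ = 0 ∧ N₂ = 0 := by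
    have e1 : 0 ≤ γ / 2 * N₁ := by positivity
    have e2 : 0 ≤ (γ - μ / 2) * N₂ := by positivity
    exact ⟨le_antisymm (nonpos_of_mul_nonpos_right (by linarith) (half_pos hγ)) hN₁0,
      le_antisymm (nonpos_of_mul_nonpos_right (by linarith) hγ') hN₂0⟩
  have h6 : ‖h‖ = 0 := pow_eq_zero_iff two_ne_zero |>.1 (by rw [hnorm, h5.1, h5.2, add_zero])
  exact sub_eq_zero.1 (norm_eq_zero.1 h6)

end Stationary

/-! ### Exponential moments of squares -/

section Moments

variable {Ω : Type*} [MeasurableSpace Ω] {P : Measure Ω}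

/-- `E exp(a W²)` exists and is at most `M`. -/
def HasExpSq (P : Measure Ω) (W : Ω → ℝ) (a M : ℝ) : Prop :=
  Integrable (fun ω => Real.exp (a * W ω ^ 2)) P ∧ ∫ ω, Real.exp (a * W ω ^ 2) ∂P ≤ M

lemma lintegral_exp_sq_gaussianReal_le :
    ∫⁻ x, ENNReal.ofReal (Real.exp (x ^ 2 / 4)) ∂(gaussianReal 0 1) ≤ ENNReal.ofReal 2 := by
  rw [gaussianReal_of_var_ne_zero 0 one_ne_zero,
    lintegral_withDensity_eq_lintegral_mul _ (measurable_gaussianPDF 0 1) (by fun_prop)]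
  have h1 : ∀ x : ℝ, (gaussianPDF 0 1 * fun x => ENNReal.ofReal (Real.exp (x ^ 2 / 4))) x
      = ENNReal.ofReal ((Real.sqrt (2 * Real.pi))⁻¹ * Real.exp (-(1 / 4) * x ^ 2)) := by
    intro x
    rw [Pi.mul_apply, gaussianPDF, ← ENNReal.ofReal_mul (gaussianPDFReal_nonneg 0 1 x),
      gaussianPDFReal, mul_assoc, ← Real.exp_add]
    congr 2
    · simp
    · congr 1
      simp only [NNReal.coe_one]
      ring
  simp only [h1]
  rw [← ofReal_integral_eq_lintegral_ofReal
    ((integrable_exp_neg_mul_sq (by norm_num : (0 : ℝ) < 1 / 4)).const_mul _)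
    (ae_of_all _ fun x => by positivity), integral_const_mul, integral_gaussian]
  refine ENNReal.ofReal_le_ofReal ?_
  have hπ := Real.pi_pos
  rw [← Real.sqrt_inv, ← Real.sqrt_mul (by positivity)]
  refine Real.sqrt_le_iff.2 ⟨by norm_num, ?_⟩
  field_simp
  norm_num

/-- Sub-Gaussian variables have exponential moments of their square: write `exp(a z²)` as the
moment generating function at `√(2a) z` of a standard Gaussian, and exchange the integrals. -/
lemma hasExpSq_of_subgaussian [SFinite P] {Z : Ω → ℝ} {c : ℝ≥0} (hm : Measurable Z)
    (h : HasSubgaussianMGF Z c P) {a : ℝ} (ha : 0 ≤ a) (hac : a * c ≤ 1 / 4) :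
    HasExpSq P Z a 2 := by
  set s := Real.sqrt (2 * a) with hs
  have hs2 : s ^ 2 = 2 * a := Real.sq_sqrt (by positivity)
  have h1 : ∀ z : ℝ, ENNReal.ofReal (Real.exp (a * z ^ 2))
      = ∫⁻ x, ENNReal.ofReal (Real.exp (s * z * x)) ∂(gaussianReal 0 1) := by
    intro z
    have h2 := congrFun (mgf_id_gaussianReal (μ := 0) (v := 1)) (s * z)
    rw [mgf] at h2
    simp only [id] at h2
    rw [← ofReal_integral_eq_lintegral_ofReal (integrable_exp_mul_gaussianReal _)
      (ae_of_all _ fun x => (Real.exp_pos _).le), h2]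
    congr 2
    rw [mul_pow, hs2, NNReal.coe_one]
    ring
  have hle : ∫⁻ ω, ENNReal.ofReal (Real.exp (a * Z ω ^ 2)) ∂P ≤ ENNReal.ofReal 2 := by
    simp only [h1]
    rw [lintegral_lintegral_swap (by fun_prop)]
    refine le_trans (lintegral_mono fun x => ?_) lintegral_exp_sq_gaussianReal_le
    have h3 : ∀ ω, s * Z ω * x = s * x * Z ω := fun ω => by ring
    simp only [h3]
    rw [← ofReal_integral_eq_lintegral_ofReal (h.integrable_exp_mul _)
      (ae_of_all _ fun x => (Real.exp_pos _).le)]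
    refine ENNReal.ofReal_le_ofReal ((h.mgf_le (s * x)).trans (Real.exp_le_exp.2 ?_))
    rw [mul_pow, hs2]
    nlinarith [mul_le_mul_of_nonneg_right hac (sq_nonneg x)]
  have hint : Integrable (fun ω => Real.exp (a * Z ω ^ 2)) P := by
    refine ⟨by fun_prop, ?_⟩
    rw [hasFiniteIntegral_iff_ofReal (ae_of_all _ fun ω => (Real.exp_pos _).le)]
    exact hle.trans_lt ENNReal.ofReal_lt_top
  refine ⟨hint, ?_⟩
  rw [← ofReal_integral_eq_lintegral_ofReal hint (ae_of_all _ fun ω => (Real.exp_pos _).le)] at hle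
  exact (ENNReal.ofReal_le_ofReal_iff (by norm_num)).1 hle

lemma HasExpSq.mono {W Z : Ω → ℝ} {a b d M : ℝ} (hZ : HasExpSq P Z b M) (hW : Measurable W)
    (h : ∀ ω, a * W ω ^ 2 ≤ b * Z ω ^ 2 + d) : HasExpSq P W a (Real.exp d * M) := by
  have h1 : ∀ ω, Real.exp (a * W ω ^ 2) ≤ Real.exp d * Real.exp (b * Z ω ^ 2) := fun ω => by
    rw [← Real.exp_add, add_comm d]
    exact Real.exp_le_exp.2 (h ω)
  have hi : Integrable (fun ω => Real.exp (a * W ω ^ 2)) P :=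
    (hZ.1.const_mul (Real.exp d)).mono' (by fun_prop) (ae_of_all _ fun ω => by
      rw [Real.norm_eq_abs, abs_of_pos (Real.exp_pos _)]
      exact h1 ω)
  refine ⟨hi, (integral_mono hi (hZ.1.const_mul (Real.exp d)) h1).trans ?_⟩
  rw [integral_const_mul]
  exact mul_le_mul_of_nonneg_left hZ.2 (Real.exp_pos _).le

lemma HasExpSq.integrable [IsFiniteMeasure P] {W : Ω → ℝ} {a M : ℝ} (h : HasExpSq P W a M)
    (hW : Measurable W) (ha : 0 < a) : Integrable W P := by
  refine ((integrable_const 1).add (h.1.div_const a)).mono' hW.aestronglyMeasurable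
    (ae_of_all _ fun ω => ?_)
  have h1 := Real.add_one_le_exp (a * W ω ^ 2)
  have h2 : W ω ^ 2 ≤ Real.exp (a * W ω ^ 2) / a := by
    rw [le_div_iff₀ ha]
    linarith
  rw [Real.norm_eq_abs, Pi.add_apply]
  nlinarith [sq_nonneg (|W ω| - 1), sq_abs (W ω), abs_nonneg (W ω)]

lemma exp_le_add_exp_sq (x : ℝ) : Real.exp x ≤ x + Real.exp (x ^ 2) := by
  have h1 := Real.add_one_le_exp (x ^ 2)
  rcases le_or_gt |x| 1 with h | h
  · have h2 := (abs_le.1 (Real.abs_exp_sub_one_sub_id_le h)).2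
    linarith
  · rcases lt_abs.1 h with hx | hx
    · have h2 : Real.exp x ≤ Real.exp (x ^ 2) := Real.exp_le_exp.2 (by nlinarith)
      linarith
    · have h2 : Real.exp x ≤ 1 := Real.exp_le_one_iff.2 (by linarith)
      nlinarith

/-- A centered variable with exponential moments of its square has a sub-Gaussian moment
generating function near `0`. The mean enters through `exp x ≤ x + exp x²`. -/
lemma HasExpSq.mgf_le [IsProbabilityMeasure P] {W : Ω → ℝ} {a M : ℝ} (h : HasExpSq P W a M)
    (hW : Measurable W) (ha : 0 < a) (hmean : ∫ ω, W ω ∂P = 0) {t : ℝ} (ht : t ^ 2 ≤ a) :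
    Integrable (fun ω => Real.exp (t * W ω)) P ∧ mgf W P t ≤ Real.exp (t ^ 2 * (M / a)) := by
  have hpt : ∀ ω, Real.exp (t * W ω)
      ≤ t * W ω + (1 + t ^ 2 / a * (Real.exp (a * W ω ^ 2) - 1)) := by
    intro ω
    have h1 := exp_le_add_exp_sq (t * W ω)
    have hs1 : t ^ 2 / a ≤ 1 := (div_le_one ha).2 ht
    have h2 := convexOn_exp.2 (Set.mem_univ (a * W ω ^ 2)) (Set.mem_univ 0)
      (by positivity : 0 ≤ t ^ 2 / a) (sub_nonneg.2 hs1) (by ring)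
    simp only [smul_eq_mul, mul_zero, add_zero, Real.exp_zero, mul_one] at h2
    have h3 : t ^ 2 / a * (a * W ω ^ 2) = (t * W ω) ^ 2 := by
      field_simp
    rw [h3] at h2
    linarith
  have hint1 : Integrable (fun ω => t * W ω) P := (h.integrable hW ha).const_mul t
  have hint3 : Integrable (fun ω => t ^ 2 / a * (Real.exp (a * W ω ^ 2) - 1)) P :=
    (h.1.sub (integrable_const 1)).const_mul _
  have hint2 : Integrable (fun ω => 1 + t ^ 2 / a * (Real.exp (a * W ω ^ 2) - 1)) P :=
    (integrable_const 1).add hint3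
  have hint : Integrable (fun ω => Real.exp (t * W ω)) P :=
    (hint1.add hint2).mono' (by fun_prop) (ae_of_all _ fun ω => by
      rw [Real.norm_eq_abs, abs_of_pos (Real.exp_pos _)]
      exact hpt ω)
  refine ⟨hint, ?_⟩
  have h4 : mgf W P t ≤ 1 + t ^ 2 / a * (∫ ω, Real.exp (a * W ω ^ 2) ∂P - 1) := by
    refine (integral_mono hint (hint1.add hint2) hpt).trans (le_of_eq ?_)
    simp only [Pi.add_apply]
    rw [integral_add hint1 hint2, integral_const_mul, hmean, integral_add (integrable_const 1)
      hint3, integral_const_mul,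
      integral_sub h.1 (integrable_const 1)]
    simp
  have h5 : 0 ≤ t ^ 2 / a := by positivity
  calc mgf W P t ≤ 1 + t ^ 2 / a * (∫ ω, Real.exp (a * W ω ^ 2) ∂P - 1) := h4
    _ ≤ t ^ 2 * (M / a) + 1 := by
        have h6 := mul_le_mul_of_nonneg_left h.2 h5
        have h7 : t ^ 2 * (M / a) = t ^ 2 / a * M := by ring
        rw [h7]
        linarith
    _ ≤ Real.exp (t ^ 2 * (M / a)) := Real.add_one_le_exp _

/-! ### Tail bounds for sums -/

/-- Chernoff's bound for deviations `u` with `t = u a / (2 M)` in the range of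
`HasExpSq.mgf_le`. -/
lemma measureReal_sum_ge_le [IsProbabilityMeasure P] {n : ℕ} {W : Fin n → Ω → ℝ} {a M u : ℝ}
    (hind : iIndepFun W P) (hm : ∀ i, Measurable (W i)) (h : ∀ i, HasExpSq P (W i) a M)
    (hmean : ∀ i, ∫ ω, W i ω ∂P = 0) (ha : 0 < a) (hM : 0 < M) (hu : 0 ≤ u)
    (hua : (u * a / (2 * M)) ^ 2 ≤ a) :
    P.real {ω | n * u ≤ ∑ i, W i ω} ≤ Real.exp (-(n * u ^ 2 * (a / (4 * M)))) := by
  set t := u * a / (2 * M) with ht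
  have hmgf := fun i => (h i).mgf_le (hm i) ha (hmean i) hua
  have hint : Integrable (fun ω => Real.exp (t * (∑ i, W i) ω)) P :=
    hind.integrable_exp_mul_sum hm fun i _ => (hmgf i).1
  have h1 := measure_ge_le_exp_mul_mgf (X := ∑ i, W i) (n * u) (by positivity : 0 ≤ t) hint
  simp only [Finset.sum_apply] at h1
  refine h1.trans ?_
  rw [hind.mgf_sum hm]
  calc Real.exp (-t * (n * u)) * ∏ i, mgf (W i) P t
      ≤ Real.exp (-t * (n * u)) * ∏ _i : Fin n, Real.exp (t ^ 2 * (M / a)) :=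
        mul_le_mul_of_nonneg_left
          (Finset.prod_le_prod (fun i _ => mgf_nonneg) fun i _ => (hmgf i).2) (Real.exp_pos _).le
    _ = Real.exp (-(n * u ^ 2 * (a / (4 * M)))) := by
        rw [Finset.prod_const, Finset.card_univ, Fintype.card_fin, ← Real.exp_nat_mul,
          ← Real.exp_add]
        congr 1
        rw [ht]
        field_simp
        ring

lemma measureReal_abs_sum_ge_le [IsProbabilityMeasure P] {n : ℕ} {W : Fin n → Ω → ℝ} {a M u : ℝ}
    (hind : iIndepFun W P) (hm : ∀ i, Measurable (W i)) (h : ∀ i, HasExpSq P (W i) a M)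
    (hmean : ∀ i, ∫ ω, W i ω ∂P = 0) (ha : 0 < a) (hM : 0 < M) (hu : 0 ≤ u)
    (hua : (u * a / (2 * M)) ^ 2 ≤ a) :
    P.real {ω | n * u ≤ |∑ i, W i ω|} ≤ 2 * Real.exp (-(n * u ^ 2 * (a / (4 * M)))) := by
  have h1 := measureReal_sum_ge_le hind hm h hmean ha hM hu hua
  have h2 := measureReal_sum_ge_le (W := fun i ω => -W i ω)
    (hind.comp (fun _ x => -x) fun _ => measurable_neg) (fun i => (hm i).neg)
    (fun i => by simpa [HasExpSq] using h i)
    (fun i => by rw [integral_neg, hmean i, neg_zero]) ha hM hu hua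
  have h3 : {ω | n * u ≤ |∑ i, W i ω|}
      ⊆ {ω | n * u ≤ ∑ i, W i ω} ∪ {ω | n * u ≤ ∑ i, -W i ω} := by
    intro ω hω
    rcases le_abs.1 (show n * u ≤ |∑ i, W i ω| from hω) with h | h
    · exact Or.inl h
    · refine Or.inr ?_
      simpa using h
  have h4 := (measureReal_mono (μ := P) h3).trans (measureReal_union_le _ _)
  linarith

lemma measureReal_sum_sq_ge_le [IsProbabilityMeasure P] {n : ℕ} {Z : Fin n → Ω → ℝ} {a M B : ℝ}
    (hind : iIndepFun Z P) (hm : ∀ i, Measurable (Z i)) (h : ∀ i, HasExpSq P (Z i) a M)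
    (ha : 0 ≤ a) (hM : 0 < M) (hB : 1 + Real.log M ≤ a * B) :
    P.real {ω | n * B ≤ ∑ i, Z i ω ^ 2} ≤ Real.exp (-n) := by
  have hind' : iIndepFun (fun i ω => Z i ω ^ 2) P :=
    hind.comp (fun _ x => x ^ 2) fun _ => by fun_prop
  have hm' : ∀ i, Measurable fun ω => Z i ω ^ 2 := fun i => by fun_prop
  have hint : Integrable (fun ω => Real.exp (a * (∑ i, fun ω => Z i ω ^ 2) ω)) P :=
    hind'.integrable_exp_mul_sum hm' fun i _ => (h i).1
  have h1 := measure_ge_le_exp_mul_mgf (X := ∑ i, fun ω => Z i ω ^ 2) (n * B) ha hint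
  simp only [Finset.sum_apply] at h1
  refine h1.trans ?_
  rw [hind'.mgf_sum hm']
  calc Real.exp (-a * (n * B)) * ∏ i, mgf (fun ω => Z i ω ^ 2) P a
      ≤ Real.exp (-a * (n * B)) * ∏ _i : Fin n, Real.exp (Real.log M) := by
        refine mul_le_mul_of_nonneg_left
          (Finset.prod_le_prod (fun i _ => mgf_nonneg) fun i _ => ?_) (Real.exp_pos _).le
        rw [Real.exp_log hM]
        exact (h i).2
    _ = Real.exp (-a * (n * B) + n * Real.log M) := by
        rw [Finset.prod_const, Finset.card_univ, Fintype.card_fin, ← Real.exp_nat_mul,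
          ← Real.exp_add]
    _ ≤ Real.exp (-n) := by
        refine Real.exp_le_exp.2 ?_
        nlinarith [mul_le_mul_of_nonneg_left hB (Nat.cast_nonneg (α := ℝ) n)]

end Moments

/-! ### The score of one observation -/

section Score

variable {Ω : Type*} [MeasurableSpace Ω] {P : Measure Ω} {p : ℕ} {l : ℝ → ℝ} {w v : Vec p → ℝ}
  {k₀ : ℝ≥0} {k₁ k₂ κ : ℝ} {x : Ω → Vec p} {e : Ω → ℝ}

lemma measurable_apply (m : Fin p) : Measurable fun b : Vec p => b m := by fun_prop

lemma measurable_score (hw : Measurable w) (hv : Measurable v) (hx : Measurable x)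
    (he : Measurable e) (m : Fin p) :
    Measurable fun ω => w (x ω) * x ω m * deriv l (e ω * v (x ω)) := by
  have h1 := measurable_deriv l
  exact ((hw.comp hx).mul ((measurable_apply m).comp hx)).mul
    (h1.comp (he.mul (hv.comp hx)))

/-- A variable with a sub-Gaussian centering and mean at most `κ` has exponential moments of its
square. -/
lemma IsSubGaussian.hasExpSq [IsProbabilityMeasure P] {Z : Ω → ℝ} {c : ℝ≥0}
    (h : IsSubGaussian P Z c) (hm : Measurable Z) (hκ : |∫ ω, Z ω ∂P| ≤ κ) {a : ℝ} (ha : 0 ≤ a)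
    (hac : a * c ≤ 1 / 4) : HasExpSq P Z (a / 2) (Real.exp (a * κ ^ 2) * 2) := by
  refine (hasExpSq_of_subgaussian (by fun_prop) h ha hac).mono hm fun ω => ?_
  set z := ∫ ω', Z ω' ∂P
  have h1 : z ^ 2 ≤ κ ^ 2 := sq_le_sq' (abs_le.1 hκ).1 (abs_le.1 hκ).2
  nlinarith [mul_nonneg ha (sq_nonneg (Z ω - 2 * z)), mul_le_mul_of_nonneg_left h1 ha]

lemma integral_score [IsProbabilityMeasure P] (hw : Measurable w) (hv : Measurable v)
    (hx : Measurable x) (he : Measurable e) (hl : IsRobustLoss l k₁ k₂)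
    (hind : IndepFun x e P) (h : IsErrorCovariate P l w v k₀ x e) {m : Fin p}
    (hint : Integrable (fun ω => w (x ω) * x ω m) P) :
    ∫ ω, w (x ω) * x ω m * deriv l (e ω * v (x ω)) ∂P = 0 := by
  have hd := measurable_deriv l
  have hwx : Measurable fun b : Vec p => w b * b m := hw.mul (measurable_apply m)
  rcases h.centered with ⟨hv1, hz⟩ | hcond
  · have h1 : ∫ ω, w (x ω) * x ω m * deriv l (e ω * v (x ω)) ∂P
        = ∫ ω, w (x ω) * x ω m * deriv l (e ω) ∂P := by
      refine integral_congr_ae ?_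
      filter_upwards [hv1] with ω hω
      rw [hω, mul_one]
    have h2 : IndepFun (fun ω => w (x ω) * x ω m) (fun ω => deriv l (e ω)) P :=
      hind.comp hwx hd
    rw [h1, h2.integral_fun_mul_eq_mul_integral (hwx.comp hx).aestronglyMeasurable
      (hd.comp he).aestronglyMeasurable, hz m, zero_mul]
  · set F : Ω → ℝ := fun ω => w (x ω) * x ω m with hF
    set D : Ω → ℝ := fun ω => deriv l (v (x ω) * e ω) with hD
    have hDm : Measurable D := hd.comp ((hv.comp hx).mul he)
    have hbd : ∀ ω, ‖D ω‖ ≤ k₁ := fun ω => hl.bounded _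
    have hDint : Integrable D P := Integrable.of_bound hDm.aestronglyMeasurable k₁ (ae_of_all _ hbd)
    have hFD : Integrable (F * D) P := hint.mul_bdd hDm.aestronglyMeasurable (ae_of_all _ hbd)
    have hFm : StronglyMeasurable[MeasurableSpace.comap x inferInstance] F :=
      (hwx.comp (comap_measurable x)).stronglyMeasurable
    have hpull := condExp_mul_of_stronglyMeasurable_left (μ := P) hFm hFD hDint
    have h1 : ∫ ω, w (x ω) * x ω m * deriv l (e ω * v (x ω)) ∂P = ∫ ω, (F * D) ω ∂P := by
      refine integral_congr_ae (ae_of_all _ fun ω => ?_)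
      simp only [hF, hD, Pi.mul_apply, mul_comm (e ω)]
    rw [h1, ← integral_condExp hx.comap_le, integral_congr_ae (hpull.trans
      (EventuallyEq.rfl.mul hcond))]
    simp

lemma HasExpSq.score (hw : Measurable w) (hv : Measurable v)
    (hx : Measurable x) (he : Measurable e) (hl : IsRobustLoss l k₁ k₂) (hk₁ : 0 < k₁)
    {a M : ℝ} (ha : 0 ≤ a) {m : Fin p} (h : HasExpSq P (fun ω => w (x ω) * x ω m) a M) :
    HasExpSq P (fun ω => w (x ω) * x ω m * deriv l (e ω * v (x ω))) (a / k₁ ^ 2) M := by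
  have h1 := h.mono (W := fun ω => w (x ω) * x ω m * deriv l (e ω * v (x ω)))
    (a := a / k₁ ^ 2) (d := 0) (measurable_score hw hv hx he m) fun ω => ?_
  · simpa using h1
  · set D := deriv l (e ω * v (x ω)) with hD
    have h2 : D ^ 2 ≤ k₁ ^ 2 :=
      sq_le_sq' (abs_le.1 (hl.bounded _)).1 (abs_le.1 (hl.bounded _)).2
    rw [add_zero, mul_pow, div_mul_eq_mul_div, div_le_iff₀ (by positivity), ← mul_assoc]
    exact mul_le_mul_of_nonneg_left h2 (by positivity)

end Score

/-! ### The event of large probability -/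

lemma measureReal_exists_le {Ω ι : Type*} [MeasurableSpace Ω] {P : Measure Ω}
    (s : Finset ι) (E : ι → Set Ω) {c : ℝ} (h : ∀ m ∈ s, P.real (E m) ≤ c) :
    P.real (⋃ m ∈ s, E m) ≤ s.card * c := by
  refine (measureReal_biUnion_finset_le s E).trans ((Finset.sum_le_sum h).trans (le_of_eq ?_))
  rw [Finset.sum_const, nsmul_eq_mul]

/-- With large probability, the gradient of the loss at the true vector is of order
`√(log p / n)` in all coefficients and of order `√(log p / n) / k` in the `k` coefficients of
`I`, and the empirical second moments of the weighted covariates are bounded. -/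
lemma exists_regular_event (k₀ k₃ : ℝ≥0) {k₁ : ℝ} (k₂ κ K : ℝ) (hk₁ : 0 < k₁) :
    ∃ A > 0, ∃ B > 0, ∃ D > 0,
    ∀ (Ω : Type*) [MeasurableSpace Ω] (P : Measure Ω) [IsProbabilityMeasure P]
      (n p k : ℕ) (I : Finset (Fin p)) (βs : Vec p) (X : Fin n → Ω → Vec p)
      (ε Y : Fin n → Ω → ℝ) (l : ℝ → ℝ) (w v : Vec p → ℝ),
      0 < n → 2 ≤ p → k = I.card → 0 < k →
      IsLinearModel P βs X ε Y → Measurable w → Measurable v →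
      IsRobustLoss l k₁ k₂ →
      (∀ i, IsErrorCovariate P l w v k₀ (X i) (ε i)) →
      (∀ i m, IsSubGaussian P (fun ω => v (X i ω) * X i ω m) (k₃ ^ 2)) →
      (∀ i m, |∫ ω, w (X i ω) * X i ω m ∂P| ≤ κ ∧ |∫ ω, v (X i ω) * X i ω m ∂P| ≤ κ) →
      D * Real.log p ≤ n →
      (k : ℝ) ^ 2 * Real.log k ≤ K * Real.log p →
      ∃ G : Set Ω, MeasurableSet G ∧
        1 - 6 * Real.exp (-(Real.log p / (k : ℝ) ^ 2)) ≤ P.real G ∧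
        ∀ ω ∈ G,
          (∀ m, |lossGrad l w v (fun i => X i ω) (fun i => Y i ω) βs m|
            ≤ A * Real.sqrt (Real.log p / n)) ∧
          (∀ m ∈ I, |lossGrad l w v (fun i => X i ω) (fun i => Y i ω) βs m|
            ≤ A * Real.sqrt (Real.log p / n) / k) ∧
          (∀ m, ∑ i, (w (X i ω) * X i ω m) ^ 2 ≤ n * B) ∧
          (∀ m, ∑ i, (v (X i ω) * X i ω m) ^ 2 ≤ n * B) := by
  -- `a` is small enough for the second moments of all weighted covariates
  set a : ℝ := 1 / (4 * ((k₀ : ℝ) ^ 2 + (k₃ : ℝ) ^ 2 + 1)) with ha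
  have ha0 : 0 < a := by positivity
  have hac₀ : a * ((k₀ ^ 2 : ℝ≥0) : ℝ) ≤ 1 / 4 := by
    rw [ha, NNReal.coe_pow, div_mul_eq_mul_div, div_le_div_iff₀ (by positivity) (by norm_num)]
    nlinarith [sq_nonneg (k₃ : ℝ)]
  have hac₃ : a * ((k₃ ^ 2 : ℝ≥0) : ℝ) ≤ 1 / 4 := by
    rw [ha, NNReal.coe_pow, div_mul_eq_mul_div, div_le_div_iff₀ (by positivity) (by norm_num)]
    nlinarith [sq_nonneg (k₀ : ℝ)]
  set M : ℝ := Real.exp (a * κ ^ 2) * 2 with hM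
  have hM2 : 2 ≤ M := by
    have := Real.one_le_exp (by positivity : 0 ≤ a * κ ^ 2)
    linarith
  have hM0 : 0 < M := by linarith
  set a' : ℝ := a / 2 / k₁ ^ 2 with ha'
  have ha'0 : 0 < a' := by positivity
  set b : ℝ := |K| + 2 with hb
  have hb0 : 0 < b := by positivity
  set A : ℝ := Real.sqrt (4 * M * b / a') with hA
  have hA0 : 0 < A := by positivity
  -- the constant `A` makes the exponent of the tail bound `b (n u² / A²)`
  have hA2 : A ^ 2 * (a' / (4 * M)) = b := by
    rw [hA, Real.sq_sqrt (by positivity)]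
    field_simp
  set B : ℝ := (1 + Real.log M) / (a / 2) with hB
  have hlogM : 0 < Real.log M := Real.log_pos (by linarith)
  have hB0 : 0 < B := by positivity
  have hBa : 1 + Real.log M ≤ a / 2 * B := le_of_eq (by rw [hB]; field_simp)
  refine ⟨A, hA0, B, hB0, b, hb0, ?_⟩
  intro Ω _ P _ n p k I βs X ε Y l w v hn hp hkI hk hmod hw hv hl hec hsv hmean hnp hkK
  have hn' : (0 : ℝ) < n := Nat.cast_pos.2 hn
  have hk' : (1 : ℝ) ≤ k := Nat.one_le_cast.2 hk
  have hk0 : (0 : ℝ) < k := by linarith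
  have hp' : (0 : ℝ) < p := Nat.cast_pos.2 (by omega)
  have hlp : 0 < Real.log p := Real.log_pos (Nat.one_lt_cast.2 hp)
  set q : ℝ := Real.sqrt (Real.log p / n) with hq
  have hq0 : 0 ≤ q := Real.sqrt_nonneg _
  have hq2 : n * q ^ 2 = Real.log p := by
    rw [hq, Real.sq_sqrt (by positivity)]
    field_simp
  have hbq : b * q ^ 2 ≤ 1 := by
    have h1 : n * (b * q ^ 2) ≤ n * 1 := by
      rw [mul_left_comm, hq2, mul_one]
      exact hnp
    exact le_of_mul_le_mul_left h1 hn'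
  have hwx : ∀ i m, Measurable fun ω => w (X i ω) * X i ω m := fun i m =>
    (hw.comp (hmod.meas_X i)).mul ((measurable_apply m).comp (hmod.meas_X i))
  have hvx : ∀ i m, Measurable fun ω => v (X i ω) * X i ω m := fun i m =>
    (hv.comp (hmod.meas_X i)).mul ((measurable_apply m).comp (hmod.meas_X i))
  have hpair := hmod.indep
  -- independence over the sample, and moments
  have hindw : ∀ m, iIndepFun (fun i ω => w (X i ω) * X i ω m) P := fun m =>
    hpair.comp (fun _ z => w z.1 * z.1 m) fun _ =>
      (hw.comp measurable_fst).mul ((measurable_apply m).comp measurable_fst)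
  have hindv : ∀ m, iIndepFun (fun i ω => v (X i ω) * X i ω m) P := fun m =>
    hpair.comp (fun _ z => v z.1 * z.1 m) fun _ =>
      (hv.comp measurable_fst).mul ((measurable_apply m).comp measurable_fst)
  have hexpw : ∀ i m, HasExpSq P (fun ω => w (X i ω) * X i ω m) (a / 2) M := by
    intro i m
    have h1 := (hec i).subgauss (EuclideanSpace.single m 1)
    have h2 : k₀ ^ 2 * ‖(EuclideanSpace.single m (1 : ℝ) : Vec p)‖₊ ^ 2 = k₀ ^ 2 := by
      simp
    rw [h2] at h1
    simp only [EuclideanSpace.inner_single_right, conj_trivial, one_mul] at h1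
    exact h1.hasExpSq (hwx i m) (hmean i m).1 ha0.le hac₀
  have hexpv : ∀ i m, HasExpSq P (fun ω => v (X i ω) * X i ω m) (a / 2) M := fun i m =>
    (hsv i m).hasExpSq (hvx i m) (hmean i m).2 ha0.le hac₃
  set W : Fin p → Fin n → Ω → ℝ := fun m i ω =>
    w (X i ω) * X i ω m * deriv l (ε i ω * v (X i ω)) with hW
  have hWm : ∀ m i, Measurable (W m i) := fun m i =>
    measurable_score hw hv (hmod.meas_X i) (hmod.meas_ε i) m
  have hWind : ∀ m, iIndepFun (W m) P := fun m =>
    hpair.comp (fun _ z => w z.1 * z.1 m * deriv l (z.2 * v z.1)) fun _ =>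
      measurable_score hw hv measurable_fst measurable_snd m
  have hWexp : ∀ m i, HasExpSq P (W m i) a' M := fun m i =>
    (hexpw i m).score hw hv (hmod.meas_X i) (hmod.meas_ε i) hl hk₁ (by positivity)
  have hWmean : ∀ m i, ∫ ω, W m i ω ∂P = 0 := fun m i =>
    integral_score hw hv (hmod.meas_X i) (hmod.meas_ε i) hl (hmod.indep_X_ε i) (hec i)
      ((hexpw i m).integrable (hwx i m) (by positivity))
  have htail : ∀ m, ∀ c, 0 ≤ c → c ≤ 1 → P.real {ω | n * (A * q * c) ≤ |∑ i, W m i ω|}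
      ≤ 2 * Real.exp (-(b * Real.log p * c ^ 2)) := by
    intro m c hc0 hc1
    have h1 : n * (A * q * c) ^ 2 * (a' / (4 * M)) = b * Real.log p * c ^ 2 := by
      rw [← hA2, ← hq2]
      ring
    have h2 : (A * q * c * a' / (2 * M)) ^ 2 ≤ a' := by
      have h3 : (A * q * c * a' / (2 * M)) ^ 2 = b * q ^ 2 * c ^ 2 * (a' / M) := by
        rw [← hA2]
        field_simp
        ring
      rw [h3]
      have h4 : b * q ^ 2 * c ^ 2 ≤ 1 := mul_le_one₀ hbq (sq_nonneg _) (pow_le_one₀ hc0 hc1)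
      have h5 : a' / M ≤ a' := div_le_self ha'0.le (by linarith)
      exact (mul_le_of_le_one_left (by positivity) h4).trans h5
    rw [← h1]
    exact measureReal_abs_sum_ge_le (hWind m) (hWm m) (hWexp m) (hWmean m) ha'0 hM0
      (by positivity) h2
  set E := Real.exp (-(Real.log p / (k : ℝ) ^ 2)) with hE
  have hEp : Real.exp (-Real.log p) ≤ E :=
    Real.exp_le_exp.2 (neg_le_neg (div_le_self hlp.le (one_le_pow₀ hk')))
  have hpexp : Real.exp (Real.log p) = p := Real.exp_log hp'
  -- the four bad events
  set E₁ : Set Ω := ⋃ m ∈ (Finset.univ : Finset (Fin p)), {ω | n * (A * q * 1) ≤ |∑ i, W m i ω|}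
    with hE₁
  set E₂ : Set Ω := ⋃ m ∈ I, {ω | n * (A * q * (1 / k)) ≤ |∑ i, W m i ω|} with hE₂
  set E₃ : Set Ω := ⋃ m ∈ (Finset.univ : Finset (Fin p)),
    {ω | n * B ≤ ∑ i, (w (X i ω) * X i ω m) ^ 2} with hE₃
  set E₄ : Set Ω := ⋃ m ∈ (Finset.univ : Finset (Fin p)),
    {ω | n * B ≤ ∑ i, (v (X i ω) * X i ω m) ^ 2} with hE₄
  have hb2 : 2 ≤ b := by
    have := abs_nonneg K
    linarith
  have hP₁ : P.real E₁ ≤ 2 * E := by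
    refine (measureReal_exists_le _ _ fun m _ => htail m 1 zero_le_one le_rfl).trans ?_
    rw [Finset.card_univ, Fintype.card_fin, ← hpexp, mul_left_comm, ← Real.exp_add]
    refine mul_le_mul_of_nonneg_left (le_trans (Real.exp_le_exp.2 ?_) hEp) zero_le_two
    rw [hpexp]
    nlinarith [mul_le_mul_of_nonneg_right hb2 hlp.le]
  have hP₂ : P.real E₂ ≤ 2 * E := by
    refine (measureReal_exists_le _ _ fun m _ => htail m (1 / k) (by positivity)
      ((div_le_one hk0).2 hk')).trans ?_
    rw [← hkI, ← Real.exp_log hk0, mul_left_comm, ← Real.exp_add, Real.exp_log hk0]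
    refine mul_le_mul_of_nonneg_left (Real.exp_le_exp.2 ?_) zero_le_two
    have h1 : Real.log k ≤ |K| * (Real.log p / (k : ℝ) ^ 2) := by
      rw [← mul_div_assoc, le_div_iff₀ (by positivity), mul_comm]
      exact hkK.trans (mul_le_mul_of_nonneg_right (le_abs_self K) hlp.le)
    have h2 : b * Real.log p * (1 / (k : ℝ)) ^ 2
        = |K| * (Real.log p / (k : ℝ) ^ 2) + 2 * (Real.log p / (k : ℝ) ^ 2) := by
      rw [hb]
      field_simp
    have h3 : 0 ≤ Real.log p / (k : ℝ) ^ 2 := by positivity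
    rw [h2]
    linarith
  have hsq : (p : ℝ) * Real.exp (-n) ≤ E := by
    rw [← hpexp, ← Real.exp_add]
    refine le_trans (Real.exp_le_exp.2 ?_) hEp
    nlinarith [mul_le_mul_of_nonneg_right hb2 hlp.le]
  have hP₃ : P.real E₃ ≤ E := by
    refine (measureReal_exists_le _ _ fun m _ => measureReal_sum_sq_ge_le (hindw m)
      (fun i => hwx i m) (fun i => hexpw i m) (by positivity) hM0 hBa).trans ?_
    rwa [Finset.card_univ, Fintype.card_fin]
  have hP₄ : P.real E₄ ≤ E := by
    refine (measureReal_exists_le _ _ fun m _ => measureReal_sum_sq_ge_le (hindv m)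
      (fun i => hvx i m) (fun i => hexpv i m) (by positivity) hM0 hBa).trans ?_
    rwa [Finset.card_univ, Fintype.card_fin]
  set bad := E₁ ∪ E₂ ∪ E₃ ∪ E₄ with hbad
  have hPbad : P.real bad ≤ 6 * E := by
    have h1 := measureReal_union_le (μ := P) (E₁ ∪ E₂ ∪ E₃) E₄
    have h2 := measureReal_union_le (μ := P) (E₁ ∪ E₂) E₃
    have h3 := measureReal_union_le (μ := P) E₁ E₂
    linarith
  refine ⟨(toMeasurable P bad)ᶜ, (measurableSet_toMeasurable P bad).compl, ?_, ?_⟩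
  · rw [probReal_compl_eq_one_sub (measurableSet_toMeasurable P bad), measureReal_def,
      measure_toMeasurable, ← measureReal_def]
    linarith
  · intro ω hω
    have hω' : ω ∉ bad := fun h => hω (subset_toMeasurable P bad h)
    simp only [hbad, Set.mem_union, not_or] at hω'
    obtain ⟨⟨⟨h1, h2⟩, h3⟩, h4⟩ := hω'
    simp only [hE₁, hE₂, hE₃, hE₄, Set.mem_iUnion, Finset.mem_univ, exists_prop, true_and,
      not_exists, not_and, Set.mem_ofPred_eq, not_le] at h1 h2 h3 h4
    have hgrad : ∀ m, |lossGrad l w v (fun i => X i ω) (fun i => Y i ω) βs m|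
        = (1 / (n : ℝ)) * |∑ i, W m i ω| := by
      intro m
      rw [lossGrad_apply, abs_mul, abs_neg, abs_of_pos (by positivity : 0 < 1 / (n : ℝ))]
      congr 2
      refine Finset.sum_congr rfl fun i _ => ?_
      simp only [hW, hmod.model i ω, add_sub_cancel_left]
    refine ⟨fun m => ?_, fun m hm => ?_, fun m => (h3 m).le, fun m => (h4 m).le⟩
    · rw [hgrad, one_div, inv_mul_le_iff₀ hn']
      simpa using (h1 m).le
    · rw [hgrad, one_div, inv_mul_le_iff₀ hn']
      have := (h2 m hm).le
      rwa [mul_one_div] at this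

/-! ### Stationary points equal the oracle, and thresholding -/

/-- Bounds for the gradient at the true vector make the oracle unique, close to the true vector,
equal to every stationary point in the region of restricted strong convexity, and itself
stationary. Here `q` stands for `√(log p / n)`. -/
lemma oracle_and_stationary {n p J : ℕ} {grp : Fin p → Fin J} {S : Finset (Fin J)}
    {βs : Vec p} {l : ℝ → ℝ} {w v : Vec p → ℝ} {x : Fin n → Vec p} {y : Fin n → ℝ}
    {ρ : ℝ → ℝ → ℝ} {g : ℝ → ℝ} {k₁ k₂ γ τ μ δ r lam R A B q : ℝ}
    (hk₂ : 0 < k₂) (hγ : 0 < γ) (hμ : 0 < μ) (hδ : 0 < δ) (hγμ : 3 / 4 * μ < γ) (hr : 0 < r)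
    (hA : 0 < A) (hB : 0 < B) (hq : 0 < q) (hlam : 0 < lam) (hn : 0 < n)
    (hsurj : Function.Surjective grp) (hS : 0 < (groupIndices grp S).card)
    (hβs : ∀ m, grp m ∉ S → βs m = 0)
    (hv : ∀ x, 0 < v x) (hl : IsRobustLoss l k₁ k₂) (hρ : IsFlatAmenable ρ g μ δ)
    (hτ : 0 ≤ τ * (Real.log p / n))
    (hk : τ * (Real.log p / n) * (groupIndices grp S).card ≤ γ / 8)
    (hRlam : 8 * (τ * (Real.log p / n)) * R ≤ lam)
    (hβsR : l1norm βs ≤ R / 2) (hqR : 2 * A / γ * q ≤ R / 2)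
    (hqlam : (A + k₂ * B * (2 * A / γ)) * q ≤ lam / 4)
    (hqr : 2 * A / γ * q / Real.sqrt (groupIndices grp S).card < r)
    (hbig : ∀ j ∈ S, (δ + 4 * max 1 (μ * δ) / γ) * (Real.sqrt (groupSize grp j) * lam)
      + 2 * A / γ * q / Real.sqrt (groupIndices grp S).card ≤ groupNorm grp βs j)
    (hG : ∀ m, |lossGrad l w v x y βs m| ≤ A * q)
    (hGS : ∀ m ∈ groupIndices grp S, |lossGrad l w v x y βs m|
      ≤ A * q / (groupIndices grp S).card)
    (hwB : ∀ m, ∑ i, (w (x i) * x i m) ^ 2 ≤ n * B)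
    (hvB : ∀ m, ∑ i, (v (x i) * x i m) ^ 2 ≤ n * B)
    (hRSC : RSC n (empLoss l w v x y) βs γ τ r) :
    (∃! βo, IsOracle (empLoss l w v x y) (groupIndices grp S) βs r βo) ∧
    ∀ βo, IsOracle (empLoss l w v x y) (groupIndices grp S) βs r βo →
      ‖βo - βs‖ ≤ 2 * A / γ * q / Real.sqrt (groupIndices grp S).card ∧
      IsStationary (empLoss l w v x y) grp ρ lam R βo ∧
      ∀ β, IsStationary (empLoss l w v x y) grp ρ lam R β → ‖β - βs‖ ≤ r → β = βo := by
  set I := groupIndices grp S with hI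
  set L := empLoss l w v x y with hLdef
  have hmem : ∀ m, m ∈ I ↔ grp m ∈ S := fun m => by simp [hI, groupIndices]
  have hβsI : ∀ m, m ∉ I → βs m = 0 := fun m hm => hβs m (mt (hmem m).2 hm)
  have hgrad : ∀ β, gradient L β = lossGrad l w v x y β := gradient_empLoss hl.diff hv x y
  have hL : Differentiable ℝ L := fun β =>
    (hasGradientAt_empLoss hl.diff hv x y β).differentiableAt
  have hk2 : τ * (Real.log p / n) * I.card ≤ γ / 2 := by linarith
  obtain ⟨βo, ho⟩ := exists_isOracle (I := I) (βs := βs) hL hr.le hβsI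
  refine ⟨⟨βo, ho, fun b hb => hb.unique hL hRSC hγ hτ hk2 ho⟩, fun βo ho => ?_⟩
  have hk0 : (0 : ℝ) < I.card := Nat.cast_pos.2 hS
  have hs : 0 < Real.sqrt I.card := Real.sqrt_pos.2 hk0
  have herr : ‖βo - βs‖ ≤ 2 * A / γ * q / Real.sqrt I.card := by
    have h1 := ho.norm_sub_le hL hRSC hγ hr.le hτ hk2 hS hβsI (A := A * q) (by positivity)
      (by simpa only [hgrad] using hGS)
    exact h1.trans (le_of_eq (by ring))
  have hl1 : l1norm (βo - βs) ≤ 2 * A / γ * q := by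
    refine le_of_sq_le_sq ((l1norm_sq_le (I := I) fun m hm => by
      simp [ho.1.1 m hm, hβsI m hm]).trans ?_) (by positivity)
    calc I.card * ‖βo - βs‖ ^ 2
        ≤ I.card * (2 * A / γ * q / Real.sqrt I.card) ^ 2 := by gcongr
      _ = (2 * A / γ * q) ^ 2 := by
          rw [div_pow, Real.sq_sqrt hk0.le]
          field_simp
  have hsupp : ∀ m, grp m ∉ S → βo m = 0 := fun m hm => ho.1.1 m (mt (hmem m).1 hm)
  have hR : l1norm βo ≤ R := by
    have h1 := l1norm_add_le βs (βo - βs)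
    rw [add_sub_cancel] at h1
    linarith
  have hcrit : ∀ m, grp m ∈ S → gradient L βo m = 0 := fun m hm =>
    ho.gradient_eq_zero hL (herr.trans_lt hqr) ((hmem m).2 hm)
  have hdual : ∀ m, |gradient L βo m| ≤ lam / 4 := by
    intro m
    rw [hgrad]
    have h1 := abs_lossGrad_sub_le hl hk₂ hn hwB hvB (y := y) βs βo m
    have h2 : k₂ * B * l1norm (βo - βs) ≤ k₂ * B * (2 * A / γ * q) :=
      mul_le_mul_of_nonneg_left hl1 (by positivity)
    have h3 := abs_sub_abs_le_abs_sub (lossGrad l w v x y βo m) (lossGrad l w v x y βs m)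
    have h4 := hG m
    have h5 : (A + k₂ * B * (2 * A / γ)) * q = A * q + k₂ * B * (2 * A / γ * q) := by ring
    linarith
  have hbigo : ∀ j ∈ S, (δ + 4 * max 1 (μ * δ) / γ) * (Real.sqrt (groupSize grp j) * lam)
      ≤ groupNorm grp βo j := by
    intro j hj
    have h1 := groupNorm_sub_le grp βs βo j
    have h2 := groupNorm_le_norm grp (βs - βo) j
    rw [norm_sub_rev] at h2
    linarith [hbig j hj]
  have hc : 0 < max 1 (μ * δ) := lt_max_of_lt_left one_pos
  refine ⟨herr, ?_, fun β hβ hβr => ?_⟩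
  · refine isStationary_of_critical hρ hsurj hlam hsupp hR hcrit
      (fun m => (hdual m).trans (by linarith)) fun j hj => le_trans ?_ (hbigo j hj)
    refine mul_le_mul_of_nonneg_right ?_ (by positivity)
    have : 0 < 4 * max 1 (μ * δ) / γ := by positivity
    linarith
  · exact hβ.eq_of_critical hρ hμ hδ hγ hγμ hsurj hlam hRSC hτ hk hRlam ho.1.2 hsupp hR hcrit
      hdual hbigo hβr

/-- Thresholding at a level above the error `e` of `βo` and below the signal minus `e` keeps
exactly the support of the true vector. -/
lemma hardThreshold_eq {p : ℕ} {βs βo : Vec p} {e θ : ℝ} (he : ‖βo - βs‖ ≤ e) (he0 : 0 ≤ e)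
    (hθ : e < θ) (hmin : ∀ m, βs m ≠ 0 → e + θ ≤ |βs m|) :
    hardThreshold θ βo = restrictSupport βs βo ∧ ‖hardThreshold θ βo - βs‖ ≤ e ∧
      ∀ m, hardThreshold θ βo m ≠ 0 ↔ βs m ≠ 0 := by
  have hcoord : ∀ m, |βo m - βs m| ≤ e := fun m => by
    simpa using (abs_apply_le_norm (βo - βs) m).trans he
  have hkeep : ∀ m, βs m ≠ 0 → θ ≤ |βo m| := fun m hm => by
    have h1 := abs_sub_abs_le_abs_sub (βs m) (βo m)
    rw [abs_sub_comm] at h1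
    linarith [hcoord m, hmin m hm]
  have hdrop : ∀ m, βs m = 0 → ¬ θ ≤ |βo m| := fun m hm => by
    have h1 := hcoord m
    rw [hm, sub_zero] at h1
    linarith
  have heq : hardThreshold θ βo = restrictSupport βs βo := by
    ext m
    by_cases hm : βs m = 0
    · simp [hardThreshold, restrictSupport, hm, hdrop m hm]
    · simp [hardThreshold, restrictSupport, hm, hkeep m hm]
  refine ⟨heq, ?_, fun m => ?_⟩
  · refine le_trans ?_ he
    rw [heq, EuclideanSpace.norm_eq, EuclideanSpace.norm_eq]
    refine Real.sqrt_le_sqrt (Finset.sum_le_sum fun m _ => ?_)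
    by_cases hm : βs m = 0
    · simp [restrictSupport, hm]
      positivity
    · simp [restrictSupport, hm]
  · by_cases hm : βs m = 0
    · simp [hardThreshold, hm, hdrop m hm]
    · have h1 : βo m ≠ 0 := fun h => by
        have h2 := hkeep m hm
        rw [h, abs_zero] at h2
        linarith
      simp [hardThreshold, hm, hkeep m hm, h1]

/-- The lower bound for the radius of the `ℓ₁` ball makes it a multiple of `lam / γ`. -/
lemma three_mul_le_radius_mul {γ μ lam R da g₀ : ℝ} {s : ℕ} (hμ : 0 < μ) (hγμ : 0 < 4 * γ - 3 * μ)
    (hlam : 0 < lam) (hg : 0 < g₀) (hda : 1 ≤ da) (hs : (1 : ℝ) ≤ s)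
    (hR : 12 * (1 + 3 * g₀) * da * lam * s / (4 * γ - 3 * μ) < R) : 3 * lam ≤ γ * R := by
  rw [div_lt_iff₀ hγμ] at hR
  have h2 : 1 ≤ (1 + 3 * g₀) * da * s :=
    one_le_mul_of_one_le_of_one_le (one_le_mul_of_one_le_of_one_le (by linarith) hda) hs
  have h3 := mul_le_mul_of_nonneg_left h2 hlam.le
  have h4 : 12 * lam < R * (4 * γ - 3 * μ) := by linarith
  have hR0 : 0 < R := pos_of_mul_pos_left (by linarith) hγμ.le
  have h5 : 0 < R * μ := by positivity
  linarith

/-- The lower bound `n ≥ C₀ k log p` makes restricted strong convexity effective on the support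
of the oracle, and puts the oracle into the interior of its ball. Here `q` stands for
`√(log p / n)` and `c q / √k` for the error of the oracle. -/
lemma sample_size_bounds {D τ γ c r k q : ℝ} (hD : 0 < D) (hτ : 0 < τ) (hγ : 0 < γ) (hc : 0 < c)
    (hr : 0 < r) (hk : 1 ≤ k) (hq : 0 < q)
    (h : (D + 8 * τ / γ + (c / r) ^ 2) * (k * q ^ 2) ≤ 1) :
    τ * q ^ 2 * k ≤ γ / 8 ∧ c * q / Real.sqrt k < r := by
  have hk0 : 0 < k := by linarith
  have hkq0 : 0 < k * q ^ 2 := by positivity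
  constructor
  · have h1 : 8 * τ / γ * (k * q ^ 2) ≤ 1 := by
      refine le_trans (mul_le_mul_of_nonneg_right ?_ hkq0.le) h
      have : 0 < (c / r) ^ 2 := by positivity
      linarith
    calc τ * q ^ 2 * k = γ / 8 * (8 * τ / γ * (k * q ^ 2)) := by field_simp
      _ ≤ γ / 8 * 1 := mul_le_mul_of_nonneg_left h1 (by positivity)
      _ = γ / 8 := mul_one _
  · have h1 : (c / r * q) ^ 2 < 1 := by
      refine lt_of_lt_of_le ?_ h
      have h2 : q ^ 2 ≤ k * q ^ 2 := le_mul_of_one_le_left (sq_nonneg _) hk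
      have h3 : (c / r) ^ 2 * q ^ 2 ≤ (c / r) ^ 2 * (k * q ^ 2) :=
        mul_le_mul_of_nonneg_left h2 (sq_nonneg _)
      have h4 : 0 < (D + 8 * τ / γ) * (k * q ^ 2) := by positivity
      rw [mul_pow]
      linarith
    have h5 : c / r * q < 1 := by
      by_contra! h
      exact absurd (one_le_pow₀ h) (not_le.2 h1)
    rw [div_mul_eq_mul_div, div_lt_one hr] at h5
    exact lt_of_le_of_lt (div_le_self (by positivity) (Real.one_le_sqrt.2 hk)) h5

/-- The group signal dominates both the flatness threshold of the penalty, at `lam = c₆ q`, and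
the error `c q / √k` of the oracle. -/
lemma group_signal_bound {p J : ℕ} (grp : Fin p → Fin J) (j : Fin J) {N c c₆ q k : ℝ} (hN : 0 < N)
    (hc : 0 < c) (hc₆ : 0 < c₆) (hq : 0 < q) (hda : (1 : ℝ) ≤ maxSize grp) (hk : 1 ≤ k) :
    N * (Real.sqrt (groupSize grp j) * (c₆ * q)) + c * q / Real.sqrt k
      ≤ (N * c₆ + c) * (Real.sqrt (maxSize grp) * q) := by
  have h2 : Real.sqrt (groupSize grp j) ≤ Real.sqrt (maxSize grp) :=
    Real.sqrt_le_sqrt (Nat.cast_le.2 (groupSize_le_maxSize grp j))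
  have h3 : c * q / Real.sqrt k ≤ c * (Real.sqrt (maxSize grp) * q) :=
    (div_le_self (by positivity) (Real.one_le_sqrt.2 hk)).trans (mul_le_mul_of_nonneg_left
      (le_mul_of_one_le_left hq.le (Real.one_le_sqrt.2 hda)) hc.le)
  have h4 : N * (Real.sqrt (groupSize grp j) * (c₆ * q))
      ≤ N * c₆ * (Real.sqrt (maxSize grp) * q) := by
    calc N * (Real.sqrt (groupSize grp j) * (c₆ * q))
        ≤ N * (Real.sqrt (maxSize grp) * (c₆ * q)) := by gcongr
      _ = N * c₆ * (Real.sqrt (maxSize grp) * q) := by ring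
  rw [add_mul (N * c₆)]
  exact add_le_add h4 h3

end BiLevel

set_option maxHeartbeats 800000 in
theorem theorem3 (k₀ k₃ : ℝ≥0) (k₁ k₂ κ K γ τ μ δ : ℝ)
    (hk₁ : 0 < k₁) (hk₂ : 0 < k₂) (hγ : 0 < γ) (hτ : 0 < τ) (hμ : 0 < μ) (hδ : 0 < δ)
    (hγμ : 3 / 4 * μ < γ) :
    ∃ C₄ > 0, ∃ C₅ > 0, ∃ C₇ > 0, ∃ C₆min > 0, ∀ C₆ : ℝ, C₆min < C₆ →
    ∃ C > 0, ∃ C₈ > 0, ∀ r : ℝ, 0 < r → ∃ C₀ > 0,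
    ∀ (Ω : Type*) [MeasurableSpace Ω] (P : Measure Ω) [IsProbabilityMeasure P]
      (n p J : ℕ) (grp : Fin p → Fin J) (S : Finset (Fin J)) (βs : BiLevel.Vec p)
      (X : Fin n → Ω → BiLevel.Vec p) (ε Y : Fin n → Ω → ℝ)
      (l : ℝ → ℝ) (w v : BiLevel.Vec p → ℝ) (ρ : ℝ → ℝ → ℝ) (g : ℝ → ℝ) (R lam θ : ℝ)
      (k s : ℕ) (da : ℝ),
      -- the groups, the important ones among them, and their sizes
      Function.Surjective grp → S.Nonempty → (∀ m, grp m ∉ S → βs m = 0) →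
      k = (BiLevel.groupIndices grp S).card → s = S.card → da = BiLevel.maxSize grp →
      -- the model, the loss, the errors and covariates, and the penalty
      BiLevel.IsLinearModel P βs X ε Y →
      Measurable w → Measurable v → (∀ x, 0 < w x) → (∀ x, 0 < v x) →
      BiLevel.IsRobustLoss l k₁ k₂ →
      (∀ i, BiLevel.IsErrorCovariate P l w v k₀ (X i) (ε i)) →
      (∀ i m, BiLevel.IsSubGaussian P (fun ω => v (X i ω) * X i ω m) (k₃ ^ 2)) →
      (∀ i m, |∫ ω, w (X i ω) * X i ω m ∂P| ≤ κ ∧ |∫ ω, v (X i ω) * X i ω m ∂P| ≤ κ) →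
      BiLevel.IsFlatAmenable ρ g μ δ →
      -- the tuning parameters and the sample size
      lam = C₆ * Real.sqrt (Real.log p / n) →
      8 * τ * R * (Real.log p / n) ≤ lam →
      12 * (1 + 3 * g (BiLevel.sizeRatio grp)) * da * lam * s / (4 * γ - 3 * μ) < R →
      BiLevel.l1norm βs ≤ R / 2 →
      C * (r ^ 2)⁻¹ * da * s * Real.log p ≤ n →
      C₀ * k * Real.log p ≤ n →
      (k : ℝ) ^ 2 * Real.log k ≤ K * Real.log p →
      -- the signal strengths
      (∀ j ∈ S, C₈ * Real.sqrt (da * Real.log p / n) ≤ BiLevel.groupNorm grp βs j) →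
      (∀ m, βs m ≠ 0 → C₅ * Real.sqrt (Real.log p / (k * n)) + θ ≤ |βs m|) →
      C₅ * Real.sqrt (Real.log p / (k * n)) < θ →
      -- on an event of large probability, restricted strong convexity implies the claims
      ∃ A : Set Ω, MeasurableSet A ∧
        1 - C₇ * Real.exp (-(C₄ * Real.log p / (k : ℝ) ^ 2)) ≤ P.real A ∧
        ∀ ω ∈ A, ∀ L : BiLevel.Vec p → ℝ,
          L = BiLevel.empLoss l w v (fun i => X i ω) (fun i => Y i ω) →
          BiLevel.RSC n L βs γ τ r →
          (∃ βhat, BiLevel.IsStationary L grp ρ lam R βhat ∧ ‖βhat - βs‖ ≤ r) ∧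
          (∃! βo, BiLevel.IsOracle L (BiLevel.groupIndices grp S) βs r βo) ∧
          ∀ βhat βo, BiLevel.IsStationary L grp ρ lam R βhat → ‖βhat - βs‖ ≤ r →
            BiLevel.IsOracle L (BiLevel.groupIndices grp S) βs r βo →
            BiLevel.hardThreshold θ βhat = BiLevel.restrictSupport βs βo ∧
            ‖BiLevel.hardThreshold θ βhat - βs‖
              ≤ C₅ * Real.sqrt (Real.log p / (k * n)) ∧
            ∀ m, BiLevel.hardThreshold θ βhat m ≠ 0 ↔ βs m ≠ 0 := by
  obtain ⟨A, hA, B, hB, D, hD, hevent⟩ := BiLevel.exists_regular_event k₀ k₃ k₂ κ K hk₁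
  have hγμ' : 0 < 4 * γ - 3 * μ := by linarith
  set C₅ : ℝ := 2 * A / γ with hC₅
  have hC₅0 : 0 < C₅ := by positivity
  refine ⟨1, one_pos, C₅, hC₅0, 6, by norm_num,
    4 * (A + k₂ * B * C₅) + γ * C₅, by positivity, fun C₆ hC₆ => ?_⟩
  have hC₆0 : 0 < C₆ := lt_trans (by positivity) hC₆
  have hC₆A : A + k₂ * B * C₅ ≤ C₆ / 4 := by
    have : 0 < γ * C₅ := by positivity
    linarith
  have hC₆γ : γ * C₅ ≤ C₆ := by
    have : 0 < 4 * (A + k₂ * B * C₅) := by positivity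
    linarith
  set N : ℝ := δ + 4 * max 1 (μ * δ) / γ with hN
  have hN0 : 0 < N := by
    have : 0 < max 1 (μ * δ) := lt_max_of_lt_left one_pos
    positivity
  refine ⟨1, one_pos, N * C₆ + C₅, by positivity, fun r hr => ?_⟩
  refine ⟨D + 8 * τ / γ + (C₅ / r) ^ 2, by positivity, ?_⟩
  intro Ω _ P _ n p J grp S βs X ε Y l w v ρ g R lam θ k s da hsurj hSne hβs hk hs hda
    hmod hw hv hw0 hv0 hl hec hsv hmean hρ hlam hRlam hRbig hβsR _ hn hkK hGmin hImin hθ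
  obtain ⟨j₀, hj₀⟩ := hSne
  obtain ⟨m₀, hm₀⟩ := hsurj j₀
  have hkpos : 0 < k := by
    rw [hk]
    exact Finset.card_pos.2 ⟨m₀, by simp [BiLevel.groupIndices, hm₀, hj₀]⟩
  have hk1 : (1 : ℝ) ≤ k := Nat.one_le_cast.2 hkpos
  have hk0 : (0 : ℝ) < k := by linarith
  have hs1 : (1 : ℝ) ≤ s := by
    rw [hs]
    exact Nat.one_le_cast.2 (Finset.card_pos.2 ⟨j₀, hj₀⟩)
  have hda1 : (1 : ℝ) ≤ da := by
    rw [hda]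
    exact Nat.one_le_cast.2
      ((BiLevel.groupSize_pos grp hsurj j₀).trans_le (BiLevel.groupSize_le_maxSize grp j₀))
  have hp0 : 0 < p := m₀.pos
  rcases (show p = 1 ∨ 2 ≤ p by omega) with rfl | hp
  · -- for `p = 1` the asserted probability is negative
    refine ⟨∅, MeasurableSet.empty, ?_, fun ω hω => hω.elim⟩
    simp only [Nat.cast_one, Real.log_one, mul_zero, zero_div, neg_zero, Real.exp_zero, mul_one,
      measureReal_empty]
    norm_num
  have hlp : 0 < Real.log p := Real.log_pos (Nat.one_lt_cast.2 hp)
  have hn' : (0 : ℝ) < n := lt_of_lt_of_le (by positivity) hn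
  have hnpos : 0 < n := Nat.cast_pos.1 hn'
  set q : ℝ := Real.sqrt (Real.log p / n) with hq
  have hqpos : 0 < q := Real.sqrt_pos.2 (by positivity)
  have hq2 : q ^ 2 = Real.log p / n := Real.sq_sqrt (by positivity)
  have hlam0 : 0 < lam := by rw [hlam]; positivity
  -- the three roles of the lower bound for the sample size
  have hnD : D * Real.log p ≤ n := by
    refine le_trans ?_ hn
    have h1 : D ≤ (D + 8 * τ / γ + (C₅ / r) ^ 2) * k := by
      have h2 : 0 ≤ 8 * τ / γ + (C₅ / r) ^ 2 := by positivity
      exact (by linarith : D ≤ D + 8 * τ / γ + (C₅ / r) ^ 2).trans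
        (le_mul_of_one_le_right (by positivity) hk1)
    exact mul_le_mul_of_nonneg_right h1 hlp.le
  have hkq : (D + 8 * τ / γ + (C₅ / r) ^ 2) * (k * q ^ 2) ≤ 1 := by
    rw [hq2, ← mul_div_assoc, ← mul_div_assoc, div_le_one hn', ← mul_assoc]
    exact hn
  obtain ⟨hτk, hqr⟩ := BiLevel.sample_size_bounds hD hτ hγ hC₅0 hr hk1 hqpos hkq
  rw [hq2] at hτk
  have hsk : 1 ≤ Real.sqrt k := Real.one_le_sqrt.2 hk1
  have hsk0 : 0 < Real.sqrt k := by linarith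
  -- the radius of the `ℓ₁` ball exceeds twice the `ℓ₁` error of the oracle
  have hqR : C₅ * q ≤ R / 2 := by
    have hg : 0 < g (BiLevel.sizeRatio grp) :=
      hρ.g_pos _ (BiLevel.sizeRatio_pos grp hsurj j₀)
    have h1 := BiLevel.three_mul_le_radius_mul hμ hγμ' hlam0 hg hda1 hs1 hRbig
    have h2 : γ * (C₅ * q) ≤ lam := by
      rw [hlam, ← mul_assoc]
      exact mul_le_mul_of_nonneg_right hC₆γ hqpos.le
    refine le_of_mul_le_mul_left ?_ hγ
    linarith
  have herr : C₅ * Real.sqrt (Real.log p / (k * n)) = C₅ * q / Real.sqrt k := by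
    rw [mul_comm (k : ℝ), ← div_div, Real.sqrt_div (by positivity), mul_div_assoc]
  have hbig : ∀ j ∈ S, N * (Real.sqrt (BiLevel.groupSize grp j) * lam) + C₅ * q / Real.sqrt k
      ≤ BiLevel.groupNorm grp βs j := by
    intro j hj
    refine le_trans ?_ (hGmin j hj)
    rw [mul_div_assoc da, Real.sqrt_mul (by linarith), ← hq, hlam, hda]
    exact BiLevel.group_signal_bound grp j hN0 hC₅0 hC₆0 hqpos (hda ▸ hda1) hk1
  obtain ⟨G, hGmeas, hGP, hG⟩ := hevent Ω P n p k (BiLevel.groupIndices grp S) βs X ε Y l w v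
    hnpos hp hk hkpos hmod hw hv hl hec hsv hmean hnD hkK
  refine ⟨G, hGmeas, by rwa [one_mul], ?_⟩
  rintro ω hω L rfl hRSC
  obtain ⟨hg1, hg2, hg3, hg4⟩ := hG ω hω
  rw [hk] at hτk hqr hbig herr hg2
  have hqlam : (A + k₂ * B * C₅) * q ≤ lam / 4 := by
    rw [hlam, mul_div_right_comm]
    exact mul_le_mul_of_nonneg_right hC₆A hqpos.le
  obtain ⟨⟨βo, ho, huniq⟩, hall⟩ := BiLevel.oracle_and_stationary hk₂ hγ hμ hδ hγμ hr hA hB hqpos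
    hlam0 hnpos hsurj (hk ▸ hkpos) hβs hv0 hl hρ (by positivity) hτk (by linarith) hβsR hqR hqlam
    hqr hbig hg1 hg2 hg3 hg4 hRSC
  refine ⟨⟨βo, (hall βo ho).2.1, ho.1.2⟩, ⟨βo, ho, huniq⟩, ?_⟩
  intro βhat βo' hhat hhatr ho'
  obtain ⟨hdist, -, hsame⟩ := hall βo' ho'
  rw [hsame βhat hhat hhatr]
  rw [hk, herr] at hImin hθ ⊢
  exact BiLevel.hardThreshold_eq hdist (by positivity) hθ hImin
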